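/- Let $L>0$, $T>0$, $0<v<1$, and write $\mathbf I_t=(vt,L+vt)$. Let $\phi^0\in H^1_0(0,L)$ with weak derivative $\phi^0_x$, and let $\phi^1\in L^2(0,L)$, both real-valued. Consider the problem $$\phi_{tt}-\phi_{xx}=0\ \ (x\in\mathbf I_t,\ 0<t<T),\qquad \phi(vt,t)=\phi(L+vt,t)=0,\qquad \phi(x,0)=\phi^0(x),\ \ \phi_t(x,0)=\phi^1(x)\ \ (x\in\mathbf I_0),$$ where a solution is a real-valued $\phi\in C([0,T];H^1_0(\mathbf I_t))$ with $\phi_t\in C([0,T];L^2(\mathbf I_t))$ satisfying the wave equation in the weak sense (continuity in time being understood after the change of variable $x=\eta+vt$, $\eta\in(0,L)$, and $\phi(\cdot,t)$ being identified with its continuous representative). Put $$\gamma_v=\frac{1+v}{1-v},\qquad L_1=\frac{1-v}{1+v}L,\qquad L_2=\frac{2}{1-v}L,$$ and define, for almost every $x\in(-L_1,L_2)$, $$\tilde\phi^0_x(x)=\begin{cases}\gamma_v\,\phi^0_x(-\gamma_v x), & -L_1<x<0,\\ \phi^0_x(x), & 0<x<L,\\ \frac1{\gamma_v}\,\phi^0_x\!\left(-\frac{x}{\gamma_v}+\frac{2L}{1+v}\right),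 & L<x<L_2,\end{cases}\qquad \tilde\phi^1(x)=\begin{cases}-\gamma_v\,\phi^1(-\gamma_v x), & -L_1<x<0,\\ \phi^1(x), & 0<x<L,\\ -\frac1{\gamma_v}\,\phi^1\!\left(-\frac{x}{\gamma_v}+\frac{2L}{1+v}\right), & L<x<L_2.\end{cases}$$ Then for every $n\in\mathbb Z\setminus\{0\}$ the two expressions $$c_n=\frac1{4n\pi i}\int_0^{L_2}\left(\tilde\phi^0_x+\tilde\phi^1\right)e^{-n\pi i(1-v)x/L}\,dx=\frac1{4n\pi i}\int_{-L_1}^{L}\left(\tilde\phi^0_x-\tilde\phi^1\right)e^{n\pi i(1+v)x/L}\,dx$$ are equal. Moreover the problem has exactly one solution, and it is given by $$\phi(x,t)=\sum_{n\in\mathbb Z\setminus\{0\}}c_n\left(e^{n\pi i(1-v)(t+x)/L}-e^{n\pi i(1+v)(t-x)/L}\right),\qquad t\in[0,T],\ x\in[vt,L+vt],$$ the series converging unconditionally at each such point. -/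

import Mathlib

open MeasureTheory Filter Topology
open scoped ContDiff

namespace MovingString

noncomputable section

/-- `ψ ∈ C_c^∞(U)`, real valued. -/
def IsTestFun {E : Type*} [NormedAddCommGroup E] [NormedSpace ℝ E] (U : Set E) (ψ : E → ℝ) : Prop :=
  ContDiff ℝ ∞ ψ ∧ HasCompactSupport ψ ∧ tsupport ψ ⊆ U

/-- `f ∈ L²(a,b)`. -/
def MemL2 (a b : ℝ) (f : ℝ → ℝ) : Prop :=
  MemLp f 2 (volume.restrict (Set.Ioo a b))

/-- The norm of `L²(a,b)`. -/
def l2Norm (a b : ℝ) (f : ℝ → ℝ) : ENNReal :=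
  eLpNorm f 2 (volume.restrict (Set.Ioo a b))

/-- `u ∈ H¹₀(a,b)` and `g` is (a representative of) its weak derivative: the pair `(u,g)` is the
limit in `L² × L²` of pairs `(ψₖ, ψₖ')` with `ψₖ ∈ C_c^∞(a,b)`, i.e. `u` lies in the closure of
`C_c^∞(a,b)` for the `H¹` norm. -/
def HasH10Deriv (a b : ℝ) (u g : ℝ → ℝ) : Prop :=
  MemL2 a b u ∧ MemL2 a b g ∧
    ∃ ψ : ℕ → ℝ → ℝ, (∀ k, IsTestFun (Set.Ioo a b) (ψ k)) ∧
      Tendsto (fun k => l2Norm a b (fun x => ψ k x - u x)) atTop (𝓝 0) ∧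
      Tendsto (fun k => l2Norm a b (fun x => deriv (ψ k) x - g x)) atTop (𝓝 0)

/-- `f ∈ C([0,T]; L²(I_t))` with `I_t = (vt, L+vt)`: every `f(·,t)` is in `L²(I_t)`, and after
transport to the fixed interval `(0,L)` by `x = η + vt` the map `t ↦ f(·+vt,t)` is continuous
from `[0,T]` to `L²(0,L)`. -/
def ContL2 (v L T : ℝ) (f : ℝ → ℝ → ℝ) : Prop :=
  (∀ t ∈ Set.Icc 0 T, MemL2 (v * t) (L + v * t) (fun x => f x t)) ∧
  ∀ s ∈ Set.Icc 0 T,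
    Tendsto (fun t => l2Norm 0 L (fun η => f (η + v * t) t - f (η + v * s) s))
      (𝓝[Set.Icc 0 T] s) (𝓝 0)

/-- The space-time domain `{(x,t) : 0 < t < T, vt < x < L + vt}`. -/
def domainQ (v L T : ℝ) : Set (ℝ × ℝ) :=
  {p | 0 < p.2 ∧ p.2 < T ∧ v * p.2 < p.1 ∧ p.1 < L + v * p.2}

/-- The integral `∫₀ᵀ ∫_{I_t} F(x,t) dx dt`. -/
def integralQ (v L T : ℝ) (F : ℝ → ℝ → ℝ) : ℝ :=
  ∫ t in (0 : ℝ)..T, ∫ x in (v * t)..(L + v * t), F x t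

/-- Partial derivative with respect to the space variable. -/
def dX (ψ : ℝ × ℝ → ℝ) (x t : ℝ) : ℝ := deriv (fun y => ψ (y, t)) x

/-- Partial derivative with respect to time. -/
def dT (ψ : ℝ × ℝ → ℝ) (x t : ℝ) : ℝ := deriv (fun s => ψ (x, s)) t

/-- `φ` is a (finite energy weak) solution on `[0,T]` of `φ_tt - φ_xx = 0` in the moving interval
`(vt, L+vt)`, with `φ = 0` at both moving endpoints and `φ(·,0) = φ0`, `φ_t(·,0) = φ1`:
`φ ∈ C([0,T]; H¹₀(I_t))`, `φ_t ∈ C([0,T]; L²(I_t))`, and the equation holds against all test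
functions.  The boundary conditions are contained in `φ(·,t) ∈ H¹₀(I_t)`. -/
def IsSolution (v L T : ℝ) (φ0 φ1 : ℝ → ℝ) (φ : ℝ → ℝ → ℝ) : Prop :=
  ∃ φx φt : ℝ → ℝ → ℝ,
    -- `φ(·,t) ∈ H¹₀(I_t)` with weak derivative `φx(·,t)`
    (∀ t ∈ Set.Icc 0 T,
      HasH10Deriv (v * t) (L + v * t) (fun x => φ x t) (fun x => φx x t)) ∧
    -- continuity in time
    ContL2 v L T φ ∧ ContL2 v L T φx ∧ ContL2 v L T φt ∧
    -- `φt` is the weak time derivative of `φ`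
    (∀ ψ, IsTestFun (domainQ v L T) ψ →
      integralQ v L T (fun x t => φ x t * dT ψ x t)
        = - integralQ v L T (fun x t => φt x t * ψ (x, t))) ∧
    -- the wave equation in the weak sense
    (∀ ψ, IsTestFun (domainQ v L T) ψ →
      integralQ v L T (fun x t => φt x t * dT ψ x t - φx x t * dX ψ x t) = 0) ∧
    -- initial conditions
    (∀ᵐ x ∂(volume.restrict (Set.Ioo 0 L)), φ x 0 = φ0 x) ∧
    (∀ᵐ x ∂(volume.restrict (Set.Ioo 0 L)), φt x 0 = φ1 x)

/-- `γ_v = (1+v)/(1-v)`. -/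
def gam (v : ℝ) : ℝ := (1 + v) / (1 - v)

/-- `L₁ = (1-v)/(1+v) L`. -/
def L₁ (v L : ℝ) : ℝ := (1 - v) / (1 + v) * L

/-- `L₂ = 2/(1-v) L`. -/
def L₂ (v L : ℝ) : ℝ := 2 / (1 - v) * L

/-- The extension to `(-L₁, L₂)` of the derivative `g` of the initial shape. -/
def extX (v L : ℝ) (g : ℝ → ℝ) (x : ℝ) : ℝ :=
  if x < 0 then gam v * g (gam v * (-x))
  else if x < L then g x
  else 1 / gam v * g (1 / gam v * (-x) + 2 * L / (1 + v))

/-- The extension to `(-L₁, L₂)` of the initial velocity `h`. -/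
def extT (v L : ℝ) (h : ℝ → ℝ) (x : ℝ) : ℝ :=
  if x < 0 then -(gam v) * h (gam v * (-x))
  else if x < L then h x
  else -1 / gam v * h (1 / gam v * (-x) + 2 * L / (1 + v))

/-- The coefficient computed over `(0, L₂)`; `g` is the derivative of the initial shape and `h`
the initial velocity. -/
def coeffPlus (v L : ℝ) (g h : ℝ → ℝ) (n : ℤ) : ℂ :=
  1 / (4 * n * Real.pi * Complex.I) *
    ∫ x in (0 : ℝ)..(L₂ v L), ((extX v L g x + extT v L h x : ℝ) : ℂ) *
      Complex.exp (-(n * Real.pi * Complex.I * (1 - v) * x / L))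

/-- The coefficient computed over `(-L₁, L)`. -/
def coeffMinus (v L : ℝ) (g h : ℝ → ℝ) (n : ℤ) : ℂ :=
  1 / (4 * n * Real.pi * Complex.I) *
    ∫ x in (-(L₁ v L))..L, ((extX v L g x - extT v L h x : ℝ) : ℂ) *
      Complex.exp (n * Real.pi * Complex.I * (1 + v) * x / L)

/-- The `n`-th mode `e^{nπi(1-v)(t+x)/L} - e^{nπi(1+v)(t-x)/L}`. -/
def mode (v L : ℝ) (n : ℤ) (x t : ℝ) : ℂ :=
  Complex.exp (n * Real.pi * Complex.I * (1 - v) * (t + x) / L)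
    - Complex.exp (n * Real.pi * Complex.I * (1 + v) * (t - x) / L)

end

end MovingString

namespace MovingString

/-! Existence is d'Alembert's formula. With `γ = gam v`, one looks for `φ(x,t) = F(t+x) -
F(γ(t-x))`. Since `γ(1-v) = 1+v`, this vanishes identically at `x = vt`; at `x = L+vt` the two
arguments differ by `L + γL = L₂`, so the second boundary condition holds when `F` has period `L₂`.
For `f = F'` the initial data require `f(x) + γ f(-γx) = φ0x(x)` and `f(x) - γ f(-γx) = φ1(x)` on
`(0,L)`, which prescribes `f` on `(0,L)` and on `(-γL,0)`, that is on one full period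
(`exists_isProfile`). The mean of `f` over a period is that of `φ0x`, which is zero because `φ0` is
in `H¹₀`; hence `F` is periodic too.

As `f` is locally square integrable, the Fourier coefficients of `F` are absolutely summable
(`exists_hasSum_fourier_primitive`). Subtracting the series at `γ(t-x)` from the one at `t+x`
cancels the constant term and leaves the stated series (`IsProfile.hasSum`). Both formulas for `c_n`
are the `n`-th Fourier integral of `f`: on `(0,L₂)` the sum of the extended data is `2f(x)`, on
`(-L₁,L)` their difference is `2γ f(-γx)`, and `x ↦ -γx` carries `(-L₁,L)` onto a period.

Uniqueness comes from a conservation law and not from an energy estimate. The `n`-th coefficient of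
the data is a pairing with spatial modes on `(0,L)`; testing the weak equation with these modes in
the frame `η = x - vt` shows that the coefficient of the state at time `t` is `e^{nπi(1-v²)t/L} c_n`
(`EnergyCurves.conservation`, `coeffPlus_of_isSolution`). The modes acquire the same phase, so the
time-zero expansion applied to the state at time `t` is the asserted series. Every solution is
therefore the sum of one fixed series. -/

/-! ### Square integrable functions and integration by parts on an interval. -/

theorem intervalIntegral_eq_integral_Ioo {E : Type*} [NormedAddCommGroup E] [NormedSpace ℝ E]
    {a b : ℝ} (hab : a ≤ b) (f : ℝ → E) :
    ∫ x in a..b, f x = ∫ x in Set.Ioo a b, f x := by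
  rw [intervalIntegral.integral_of_le hab, integral_Ioc_eq_integral_Ioo]

theorem MemL2.integrableOn {a b : ℝ} {f : ℝ → ℝ} (hf : MemL2 a b f) :
    IntegrableOn f (Set.Ioo a b) :=
  MemLp.integrable one_le_two hf

theorem MemL2.intervalIntegrable {a b : ℝ} {f : ℝ → ℝ} (hf : MemL2 a b f) (hab : a ≤ b) :
    IntervalIntegrable f volume a b := by
  rw [intervalIntegrable_iff_integrableOn_Ioo_of_le hab]
  exact hf.integrableOn

theorem MemL2.integrable_mul {a b : ℝ} {f g : ℝ → ℝ} (hf : MemL2 a b f) (hg : MemL2 a b g) :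
    IntegrableOn (fun x => f x * g x) (Set.Ioo a b) :=
  MemLp.integrable_mul (p := 2) (q := 2) hf hg

theorem MemL2.mono {a b c d : ℝ} {f : ℝ → ℝ} (hf : MemL2 a b f) (hac : a ≤ c) (hdb : d ≤ b) :
    MemL2 c d f :=
  hf.mono_measure (Measure.restrict_mono (Set.Ioo_subset_Ioo hac hdb) le_rfl)

theorem memL2_of_continuousOn {a b : ℝ} {f : ℝ → ℝ} (hf : ContinuousOn f (Set.Icc a b)) :
    MemL2 a b f := by
  obtain ⟨C, hC⟩ := isCompact_Icc.exists_bound_of_continuousOn hf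
  refine MemLp.of_bound ((hf.mono Set.Ioo_subset_Icc_self).aestronglyMeasurable
    measurableSet_Ioo) C ?_
  filter_upwards [ae_restrict_mem measurableSet_Ioo] with x hx
  exact hC x (Set.Ioo_subset_Icc_self hx)

theorem MemL2.congr {a b : ℝ} {f g : ℝ → ℝ} (hf : MemL2 a b f)
    (h : ∀ x ∈ Set.Ioo a b, f x = g x) : MemL2 a b g := by
  refine (memLp_congr_ae ?_).1 hf
  filter_upwards [ae_restrict_mem measurableSet_Ioo] with x hx using h x hx

/-- Pairing with a fixed square integrable function is continuous for the `L²` norm. -/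
theorem tendsto_integral_mul {a b : ℝ} (hab : a ≤ b) {ι : Type*} {l : Filter ι}
    {f : ι → ℝ → ℝ} {u k : ℝ → ℝ} (hf : ∀ i, MemL2 a b (f i)) (hu : MemL2 a b u)
    (hk : MemL2 a b k) (h : Tendsto (fun i => l2Norm a b (fun x => f i x - u x)) l (𝓝 0)) :
    Tendsto (fun i => ∫ x in a..b, f i x * k x) l (𝓝 (∫ x in a..b, u x * k x)) := by
  have h1 : Tendsto (fun i => (hf i).toLp (f i)) l (𝓝 (hu.toLp u)) :=
    (Lp.tendsto_Lp_iff_tendsto_eLpNorm'' f hf u hu).2 h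
  have h2 : Tendsto (fun i => (inner ℝ (hk.toLp k) ((hf i).toLp (f i)) : ℝ)) l
      (𝓝 (inner ℝ (hk.toLp k) (hu.toLp u))) := tendsto_const_nhds.inner h1
  have key : ∀ w, (hw : MemL2 a b w) →
      (inner ℝ (hk.toLp k) (hw.toLp w) : ℝ) = ∫ x in a..b, w x * k x := by
    intro w hw
    rw [L2.inner_def, intervalIntegral_eq_integral_Ioo hab]
    refine integral_congr_ae ?_
    filter_upwards [hw.coeFn_toLp, hk.coeFn_toLp] with x h1 h2
    simp [h1, h2]
  rw [key u hu] at h2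
  exact h2.congr fun i => key _ (hf i)

/-- Integration by parts for a primitive of an integrable function. -/
theorem integral_primitive_mul_deriv {a b c : ℝ} {f F k k' : ℝ → ℝ} (hc : c ∈ Set.uIcc a b)
    (hf : IntervalIntegrable f volume a b) (C : ℝ)
    (hF : ∀ x ∈ Set.uIcc a b, F x = C + ∫ y in c..x, f y)
    (hk : ∀ x, HasDerivAt k (k' x) x) (hk' : Continuous k') :
    ∫ x in a..b, F x * k' x = F b * k b - F a * k a - ∫ x in a..b, f x * k x := by
  set G : ℝ → ℝ := fun x => C + ∫ y in c..x, f y with hG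
  have hdk : deriv k = k' := funext fun x => (hk x).deriv
  have hGac : AbsolutelyContinuousOnInterval G a b := by
    have h0 := hf.absolutelyContinuousOnInterval_intervalIntegral hc
    have h1 : AbsolutelyContinuousOnInterval (fun _ : ℝ => C) a b :=
      ContDiffOn.absolutelyContinuousOnInterval contDiffOn_const
    exact h1.add h0
  have hkac : AbsolutelyContinuousOnInterval k a b := by
    refine ContDiffOn.absolutelyContinuousOnInterval (ContDiff.contDiffOn ?_)
    rw [contDiff_one_iff_deriv, hdk]
    exact ⟨fun x => (hk x).differentiableAt, hk'⟩
  have h := hGac.integral_mul_deriv_eq_deriv_mul hkac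
  have h1 : ∫ x in a..b, F x * k' x = ∫ x in a..b, G x * deriv k x := by
    refine intervalIntegral.integral_congr fun x hx => ?_
    simp only [hdk, hF x hx, hG]
  have h2 : ∫ x in a..b, deriv G x * k x = ∫ x in a..b, f x * k x := by
    refine intervalIntegral.integral_congr_ae ?_
    filter_upwards [hf.ae_hasDerivAt_integral] with x hx hxm
    have := (hx (Set.uIoc_subset_uIcc hxm) c hc).const_add C
    simp only [hG, this.deriv]
  rw [h1, h, h2, hF b Set.right_mem_uIcc, hF a Set.left_mem_uIcc]

/-- Lets identities proved for real test functions pass to complex exponentials, one component at a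
time. -/
theorem intervalIntegral_ofReal_mul {a b : ℝ} {f : ℝ → ℝ} {k : ℝ → ℂ}
    (hf : IntervalIntegrable f volume a b) (hk : Continuous k) :
    ∫ x in a..b, (f x : ℂ) * k x =
      ((∫ x in a..b, f x * (k x).re : ℝ) : ℂ) + ((∫ x in a..b, f x * (k x).im : ℝ) : ℂ) * Complex.I := by
  have h1 : IntervalIntegrable (fun x => f x * (k x).re) volume a b :=
    hf.mul_continuousOn (Complex.continuous_re.comp hk).continuousOn
  have h2 : IntervalIntegrable (fun x => f x * (k x).im) volume a b :=
    hf.mul_continuousOn (Complex.continuous_im.comp hk).continuousOn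
  have h1' : IntervalIntegrable (fun x => ((f x * (k x).re : ℝ) : ℂ)) volume a b :=
    ⟨Integrable.ofReal h1.1, Integrable.ofReal h1.2⟩
  have h2' : IntervalIntegrable (fun x => ((f x * (k x).im : ℝ) : ℂ)) volume a b :=
    ⟨Integrable.ofReal h2.1, Integrable.ofReal h2.2⟩
  rw [← intervalIntegral.integral_ofReal, ← intervalIntegral.integral_ofReal,
    ← intervalIntegral.integral_mul_const, ← intervalIntegral.integral_add h1'
      (h2'.mul_const _)]
  refine intervalIntegral.integral_congr fun x _ => ?_
  apply Complex.ext <;> simp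

/-- Integration by parts against a complex valued function. -/
theorem integral_primitive_mul_deriv_complex {a b c : ℝ} {f F : ℝ → ℝ} {k k' : ℝ → ℂ}
    (hc : c ∈ Set.uIcc a b)
    (hf : IntervalIntegrable f volume a b) (C : ℝ)
    (hF : ∀ x ∈ Set.uIcc a b, F x = C + ∫ y in c..x, f y)
    (hk : ∀ x, HasDerivAt k (k' x) x) (hk' : Continuous k') :
    ∫ x in a..b, (F x : ℂ) * k' x = F b * k b - F a * k a - ∫ x in a..b, (f x : ℂ) * k x := by
  have hkc : Continuous k := continuous_iff_continuousAt.2 fun x => (hk x).continuousAt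
  have hFi : IntervalIntegrable F volume a b := by
    refine ContinuousOn.intervalIntegrable ?_
    have := (hf.absolutelyContinuousOnInterval_intervalIntegral hc).continuousOn
    exact (continuousOn_const.add this).congr hF
  have hre := integral_primitive_mul_deriv hc hf C hF (k := fun x => (k x).re)
    (k' := fun x => (k' x).re)
    (fun x => Complex.reCLM.hasFDerivAt.comp_hasDerivAt x (hk x))
    (Complex.continuous_re.comp hk')
  have him := integral_primitive_mul_deriv hc hf C hF (k := fun x => (k x).im)
    (k' := fun x => (k' x).im)
    (fun x => Complex.imCLM.hasFDerivAt.comp_hasDerivAt x (hk x))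
    (Complex.continuous_im.comp hk')
  rw [intervalIntegral_ofReal_mul hFi hk', intervalIntegral_ofReal_mul hf hkc, hre, him]
  apply Complex.ext <;> simp

/-! ### Test functions and the du Bois-Reymond lemma. -/

theorem IsTestFun.memL2 {U : Set ℝ} {ψ : ℝ → ℝ} (h : IsTestFun U ψ) (a b : ℝ) : MemL2 a b ψ :=
  memL2_of_continuousOn h.1.continuous.continuousOn

theorem IsTestFun.isTestFun_deriv {U : Set ℝ} {ψ : ℝ → ℝ} (h : IsTestFun U ψ) : IsTestFun U (deriv ψ) :=
  ⟨(contDiff_infty_iff_deriv.1 h.1).2, h.2.1.deriv, tsupport_deriv_subset.trans h.2.2⟩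

theorem IsTestFun.eq_zero {E : Type*} [NormedAddCommGroup E] [NormedSpace ℝ E] {U : Set E}
    {ψ : E → ℝ} (h : IsTestFun U ψ) {x : E} (hx : x ∉ U) : ψ x = 0 := by
  by_contra hne
  exact hx (h.2.2 (subset_tsupport _ hne))

theorem IsTestFun.add {E : Type*} [NormedAddCommGroup E] [NormedSpace ℝ E] {U : Set E}
    {ψ χ : E → ℝ} (h : IsTestFun U ψ) (h' : IsTestFun U χ) : IsTestFun U (ψ + χ) :=
  ⟨h.1.add h'.1, h.2.1.add h'.2.1, (tsupport_add ψ χ).trans (Set.union_subset h.2.2 h'.2.2)⟩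

theorem IsTestFun.const_mul {E : Type*} [NormedAddCommGroup E] [NormedSpace ℝ E] {U : Set E}
    {ψ : E → ℝ} (h : IsTestFun U ψ) (c : ℝ) : IsTestFun U (fun x => c * ψ x) :=
  ⟨contDiff_const.mul h.1, h.2.1.mul_left, (tsupport_mul_subset_right (f := fun _ => c)).trans h.2.2⟩

theorem IsTestFun.exists_Icc {a b : ℝ} {ψ : ℝ → ℝ} (h : IsTestFun (Set.Ioo a b) ψ) (hab : a < b) :
    ∃ c d, a < c ∧ c ≤ d ∧ d < b ∧ ∀ x, x ∉ Set.Icc c d → ψ x = 0 := by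
  rcases (tsupport ψ).eq_empty_or_nonempty with h0 | hne
  · refine ⟨(a + b) / 2, (a + b) / 2, by linarith, le_rfl, by linarith, fun x _ => ?_⟩
    by_contra hx
    have := subset_tsupport ψ hx
    simp [h0] at this
  · obtain ⟨c, hc, hc'⟩ := h.2.1.exists_isLeast hne
    obtain ⟨d, hd, hd'⟩ := h.2.1.exists_isGreatest hne
    refine ⟨c, d, (h.2.2 hc).1, hc' hd, (h.2.2 hd).2, fun x hx => ?_⟩
    by_contra hne
    have := subset_tsupport ψ hne
    exact hx ⟨hc' this, hd' this⟩

/-- To the left of the support the primitive is zero trivially; to the right it equals the total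
integral, so mean zero is exactly what keeps the support compact. -/
theorem IsTestFun.primitive {a b : ℝ} {ψ : ℝ → ℝ} (h : IsTestFun (Set.Ioo a b) ψ) (hab : a < b)
    (h0 : ∫ x in a..b, ψ x = 0) :
    IsTestFun (Set.Ioo a b) (fun x => ∫ y in a..x, ψ y) ∧
      deriv (fun x => ∫ y in a..x, ψ y) = ψ := by
  have hd : ∀ x, HasDerivAt (fun x => ∫ y in a..x, ψ y) (ψ x) x := fun x =>
    intervalIntegral.integral_hasDerivAt_right (h.1.continuous.intervalIntegrable _ _)
      h.1.continuous.stronglyMeasurable.stronglyMeasurableAtFilter h.1.continuous.continuousAt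
  have hdd : deriv (fun x => ∫ y in a..x, ψ y) = ψ := funext fun x => (hd x).deriv
  obtain ⟨c, d, hac, hcd, hdb, hz⟩ := h.exists_Icc hab
  have hzero : ∀ x, x ∉ Set.Icc c d → ∫ y in a..x, ψ y = 0 := by
    intro x hx
    rcases not_and_or.1 hx with hx | hx
    · push Not at hx
      refine intervalIntegral.integral_zero_ae (ae_of_all _ fun y hy => hz y fun hy' => ?_)
      have : y ≤ max a x := hy.2
      have := max_lt hac hx
      linarith [hy'.1]
    · push Not at hx
      have e : ∫ y in x..b, ψ y = 0 := by
        refine intervalIntegral.integral_zero_ae (ae_of_all _ fun y hy => hz y fun hy' => ?_)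
        have : min x b < y := hy.1
        have := lt_min hx hdb
        linarith [hy'.2]
      rw [← intervalIntegral.integral_add_adjacent_intervals
        (h.1.continuous.intervalIntegrable a x) (h.1.continuous.intervalIntegrable x b), e,
        add_zero] at h0
      exact h0
  have hts : tsupport (fun x => ∫ y in a..x, ψ y) ⊆ Set.Icc c d := by
    refine closure_minimal (fun x hx => ?_) isClosed_Icc
    by_contra hx'
    exact hx (hzero x hx')
  refine ⟨⟨?_, ?_, hts.trans (Set.Icc_subset_Ioo hac hdb)⟩, hdd⟩
  · rw [contDiff_infty_iff_deriv, hdd]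
    exact ⟨fun x => (hd x).differentiableAt, h.1⟩
  · exact isCompact_Icc.of_isClosed_subset (isClosed_tsupport _) hts

theorem exists_isTestFun_integral_eq_one {a b : ℝ} (hab : a < b) :
    ∃ ψ, IsTestFun (Set.Ioo a b) ψ ∧ ∫ x in a..b, ψ x = 1 := by
  let f : ContDiffBump ((a + b) / 2) := ⟨(b - a) / 8, (b - a) / 4, by linarith, by linarith⟩
  have hts : tsupport (f.normed volume) ⊆ Set.Ioo a b := by
    rw [f.tsupport_normed_eq]
    change Metric.closedBall ((a + b) / 2) ((b - a) / 4) ⊆ _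
    rw [Real.closedBall_eq_Icc]
    exact Set.Icc_subset_Ioo (by linarith) (by linarith)
  refine ⟨f.normed volume, ⟨f.contDiff_normed, f.hasCompactSupport_normed, hts⟩, ?_⟩
  rw [intervalIntegral.integral_eq_integral_of_support_subset, f.integral_normed]
  exact (subset_tsupport _).trans (hts.trans Set.Ioo_subset_Ioc_self)

/-- The fundamental lemma of the calculus of variations on an interval. -/
theorem ae_eq_zero_of_integral_testFun {a b : ℝ} (hab : a ≤ b) {m : ℝ → ℝ} (hm : MemL2 a b m)
    (h : ∀ χ, IsTestFun (Set.Ioo a b) χ → ∫ x in a..b, m x * χ x = 0) :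
    ∀ᵐ x ∂(volume.restrict (Set.Ioo a b)), m x = 0 := by
  rw [ae_restrict_iff' measurableSet_Ioo]
  refine isOpen_Ioo.ae_eq_zero_of_integral_contDiff_smul_eq_zero
    hm.integrableOn.locallyIntegrableOn fun χ h1 h2 h3 => ?_
  have := h χ ⟨h1, h2, h3⟩
  rw [intervalIntegral_eq_integral_Ioo hab, setIntegral_eq_integral_of_forall_compl_eq_zero] at this
  · simpa [mul_comm] using this
  · intro x hx
    rw [IsTestFun.eq_zero ⟨h1, h2, h3⟩ hx, mul_zero]

/-- The du Bois-Reymond lemma. -/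
theorem ae_eq_const_of_integral_mul_deriv {a b : ℝ} (hab : a < b) {m : ℝ → ℝ} (hm : MemL2 a b m)
    (h : ∀ χ, IsTestFun (Set.Ioo a b) χ → ∫ x in a..b, m x * deriv χ x = 0) :
    ∃ c, ∀ᵐ x ∂(volume.restrict (Set.Ioo a b)), m x = c := by
  obtain ⟨θ, hθ, hθ1⟩ := exists_isTestFun_integral_eq_one hab
  set c := ∫ x in a..b, m x * θ x with hc
  have hii : ∀ χ, IsTestFun (Set.Ioo a b) χ → IntervalIntegrable (fun x => m x * χ x) volume a b :=
    fun χ hχ => (intervalIntegrable_iff_integrableOn_Ioo_of_le hab.le).2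
      (hm.integrable_mul (hχ.memL2 _ _))
  refine ⟨c, ?_⟩
  have hmc : MemL2 a b (fun x => m x - c) := MemLp.sub hm (memL2_of_continuousOn continuousOn_const)
  suffices key : ∀ χ, IsTestFun (Set.Ioo a b) χ → ∫ x in a..b, (m x - c) * χ x = 0 by
    filter_upwards [ae_eq_zero_of_integral_testFun hab.le hmc key] with x hx
    linarith
  intro χ hχ
  set s := ∫ x in a..b, χ x with hs
  -- Removing the multiple `s` of the unit-mass bump `θ` leaves mean zero, so the difference is the
  -- derivative of a test function and the hypothesis applies to it.
  have hζ := hχ.add (hθ.const_mul (-s))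
  have hζ0 : ∫ x in a..b, (χ + fun x => -s * θ x) x = 0 := by
    simp only [Pi.add_apply]
    rw [intervalIntegral.integral_add (hχ.1.continuous.intervalIntegrable _ _)
      ((hθ.const_mul (-s)).1.continuous.intervalIntegrable _ _),
      intervalIntegral.integral_const_mul, hθ1]
    ring
  obtain ⟨hp, hp'⟩ := hζ.primitive hab hζ0
  have h1 := h _ hp
  rw [hp'] at h1
  have h2 : ∫ x in a..b, m x * (χ + fun x => -s * θ x) x
      = (∫ x in a..b, m x * χ x) + -s * ∫ x in a..b, m x * θ x := by
    rw [← intervalIntegral.integral_const_mul, ← intervalIntegral.integral_add (hii χ hχ)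
      ((hii θ hθ).const_mul _)]
    refine intervalIntegral.integral_congr fun x _ => ?_
    simp only [Pi.add_apply]; ring
  have h3 : ∫ x in a..b, (m x - c) * χ x = (∫ x in a..b, m x * χ x) - c * s := by
    rw [hs, ← intervalIntegral.integral_const_mul, ← intervalIntegral.integral_sub (hii χ hχ)
      ((hχ.1.continuous.intervalIntegrable _ _).const_mul _)]
    refine intervalIntegral.integral_congr fun x _ => ?_
    ring
  rw [h3]
  rw [h2, ← hc] at h1
  linarith

/-- A continuous function on `[0,T]` whose weak derivative is continuous is its primitive. -/
theorem eq_add_integral_of_weak_deriv {T : ℝ} (hT : 0 < T) {m k : ℝ → ℝ} (hm : Continuous m)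
    (hk : Continuous k)
    (h : ∀ χ, IsTestFun (Set.Ioo 0 T) χ →
      ∫ t in (0 : ℝ)..T, m t * deriv χ t = -∫ t in (0 : ℝ)..T, k t * χ t) :
    ∀ t ∈ Set.Icc 0 T, m t = m 0 + ∫ s in (0 : ℝ)..t, k s := by
  have hKc : Continuous fun t => ∫ s in (0 : ℝ)..t, k s :=
    intervalIntegral.continuous_primitive (fun _ _ => hk.intervalIntegrable _ _) 0
  -- `M` has zero weak derivative, hence is almost everywhere constant; continuity makes it constant
  -- on the closed interval, endpoints included.
  set M : ℝ → ℝ := fun t => m t - ∫ s in (0 : ℝ)..t, k s with hM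
  have hMc : Continuous M := hm.sub hKc
  obtain ⟨c, hc⟩ := ae_eq_const_of_integral_mul_deriv hT
    (memL2_of_continuousOn hMc.continuousOn) fun χ hχ => by
      have hdc := hχ.isTestFun_deriv.1.continuous
      have h1 := integral_primitive_mul_deriv (a := 0) (b := T) (c := 0) Set.left_mem_uIcc
        (hk.intervalIntegrable _ _) 0 (F := fun t => ∫ s in (0 : ℝ)..t, k s)
        (fun x _ => (zero_add _).symm)
        (fun x => (hχ.1.differentiable (by simp) x).hasDerivAt) hdc
      rw [hχ.eq_zero (x := T) (by simp), hχ.eq_zero (x := 0) (by simp)] at h1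
      simp only [hM, sub_mul]
      have i1 : IntervalIntegrable (fun t => m t * deriv χ t) volume 0 T :=
        (hm.mul hdc).intervalIntegrable _ _
      have i2 : IntervalIntegrable (fun t => (∫ s in (0 : ℝ)..t, k s) * deriv χ t) volume 0 T :=
        (hKc.mul hdc).intervalIntegrable _ _
      rw [intervalIntegral.integral_sub i1 i2, h χ hχ, h1]
      ring
  have he : Set.EqOn M (fun _ => c) (Set.Icc 0 T) := by
    refine Measure.eqOn_Icc_of_ae_eq volume hT.ne ?_ hMc.continuousOn continuousOn_const
    rw [Filter.EventuallyEq, restrict_Ioo_eq_restrict_Icc.symm]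
    exact hc
  intro t ht
  have h1 := he ht
  have h2 := he (Set.left_mem_Icc.2 hT.le)
  simp only [hM, intervalIntegral.integral_same] at h1 h2
  linarith

/-! ### The space `H¹₀` on an interval and primitives of mean-zero functions. -/

theorem IsTestFun.eq_integral_deriv {a b : ℝ} {ψ : ℝ → ℝ} (h : IsTestFun (Set.Ioo a b) ψ) (x : ℝ) :
    ψ x = ∫ y in a..x, deriv ψ y := by
  rw [intervalIntegral.integral_deriv_eq_sub
    (fun y _ => h.1.differentiable (by simp) y)
    (h.isTestFun_deriv.1.continuous.intervalIntegrable _ _), h.eq_zero (x := a) (by simp), sub_zero]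

theorem IsTestFun.integral_mul_deriv_eq {a b : ℝ} {ψ k k' : ℝ → ℝ}
    (h : IsTestFun (Set.Ioo a b) ψ) (hk : ∀ x, HasDerivAt k (k' x) x) (hk' : Continuous k') :
    ∫ x in a..b, deriv ψ x * k x = -∫ x in a..b, ψ x * k' x := by
  have := integral_primitive_mul_deriv (a := a) (b := b) (c := a) Set.left_mem_uIcc
    (h.isTestFun_deriv.1.continuous.intervalIntegrable _ _) 0 (F := ψ)
    (fun x _ => by rw [zero_add]; exact h.eq_integral_deriv x) hk hk'
  rw [h.eq_zero (x := a) (by simp), h.eq_zero (x := b) (by simp)] at this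
  linarith

/-- There is no boundary term although `k` is arbitrary at the endpoints: the approximating test
functions vanish there, and both sides pass to the `L²` limit. -/
theorem HasH10Deriv.integral_mul_eq {a b : ℝ} (hab : a ≤ b) {u g k k' : ℝ → ℝ}
    (h : HasH10Deriv a b u g) (hk : ∀ x, HasDerivAt k (k' x) x) (hk' : Continuous k') :
    ∫ x in a..b, g x * k x = -∫ x in a..b, u x * k' x := by
  obtain ⟨hu, hg, ψ, hψ, h1, h2⟩ := h
  have hkc : Continuous k := continuous_iff_continuousAt.2 fun x => (hk x).continuousAt
  have t1 := tendsto_integral_mul hab (fun i => (hψ i).memL2 a b) hu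
    (memL2_of_continuousOn hk'.continuousOn) h1
  have t2 := tendsto_integral_mul hab (fun i => (hψ i).isTestFun_deriv.memL2 a b) hg
    (memL2_of_continuousOn hkc.continuousOn) h2
  refine tendsto_nhds_unique t2 ?_
  refine t1.neg.congr fun i => ?_
  exact ((hψ i).integral_mul_deriv_eq hk hk').symm

/-- Pairing the derivatives with the constant `1` on `(a,x)` turns their `L²` convergence into
convergence at every point, the endpoint `b` included. -/
theorem tendsto_of_tendsto_l2Norm_deriv {a b : ℝ} {g : ℝ → ℝ} {ψ : ℕ → ℝ → ℝ}
    (hg : MemL2 a b g) (hψ : ∀ k, IsTestFun (Set.Ioo a b) (ψ k))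
    (h2 : Tendsto (fun k => l2Norm a b (fun x => deriv (ψ k) x - g x)) atTop (𝓝 0))
    {x : ℝ} (hx : x ∈ Set.Icc a b) :
    Tendsto (fun k => ψ k x) atTop (𝓝 (∫ y in a..x, g y)) := by
  have h3 : Tendsto (fun k => l2Norm a x (fun x => deriv (ψ k) x - g x)) atTop (𝓝 0) :=
    tendsto_of_tendsto_of_tendsto_of_le_of_le tendsto_const_nhds h2 (fun _ => zero_le)
      fun k => eLpNorm_mono_measure _ (Measure.restrict_mono (Set.Ioo_subset_Ioo le_rfl hx.2) le_rfl)
  have := tendsto_integral_mul hx.1 (fun i => (hψ i).isTestFun_deriv.memL2 a x) (hg.mono le_rfl hx.2)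
    (k := fun _ => 1) (memL2_of_continuousOn continuousOn_const) h3
  simp only [mul_one] at this
  exact this.congr fun k => ((hψ k).eq_integral_deriv x).symm

/-- The derivative of a function of `H¹₀` has mean zero. -/
theorem HasH10Deriv.integral_eq_zero {a b : ℝ} (hab : a ≤ b) {u g : ℝ → ℝ}
    (h : HasH10Deriv a b u g) : ∫ x in a..b, g x = 0 := by
  obtain ⟨hu, hg, ψ, hψ, h1, h2⟩ := h
  have := tendsto_of_tendsto_l2Norm_deriv hg hψ h2 (x := b) ⟨hab, le_rfl⟩
  refine tendsto_nhds_unique this ?_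
  exact tendsto_const_nhds.congr fun k => ((hψ k).eq_zero (by simp)).symm

/-- A function of `H¹₀` is the primitive of its derivative. -/
theorem HasH10Deriv.ae_eq_integral {a b : ℝ} {u g : ℝ → ℝ} (h : HasH10Deriv a b u g) :
    ∀ᵐ x ∂(volume.restrict (Set.Ioo a b)), u x = ∫ y in a..x, g y := by
  obtain ⟨hu, hg, ψ, hψ, h1, h2⟩ := h
  -- `L²` convergence yields an almost everywhere convergent subsequence, whose limit `u` is then
  -- compared with the pointwise limit of the primitives.
  have hm : TendstoInMeasure (volume.restrict (Set.Ioo a b)) ψ atTop u :=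
    tendstoInMeasure_of_tendsto_eLpNorm two_ne_zero
      (fun k => (hψ k).1.continuous.aestronglyMeasurable) hu.1 h1
  obtain ⟨ns, hns, hae⟩ := hm.exists_seq_tendsto_ae
  filter_upwards [hae, ae_restrict_mem measurableSet_Ioo] with x hx hxm
  exact tendsto_nhds_unique hx ((tendsto_of_tendsto_l2Norm_deriv hg hψ h2
    (Set.Ioo_subset_Icc_self hxm)).comp hns.tendsto_atTop)

/-- Derivatives of test functions are dense among the square integrable functions of mean zero. -/
theorem exists_deriv_testFun_tendsto {a b : ℝ} (hab : a < b) {g : ℝ → ℝ} (hg : MemL2 a b g)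
    (h0 : ∫ x in a..b, g x = 0) :
    ∃ ψ : ℕ → ℝ → ℝ, (∀ k, IsTestFun (Set.Ioo a b) (ψ k)) ∧
      Tendsto (fun k => l2Norm a b (fun x => deriv (ψ k) x - g x)) atTop (𝓝 0) := by
  set μ := volume.restrict (Set.Ioo a b) with hμ
  have hdiff : ∀ {ψ : ℝ → ℝ}, IsTestFun (Set.Ioo a b) ψ → Differentiable ℝ ψ :=
    fun h => h.1.differentiable (by simp)
  let S : Submodule ℝ (Lp ℝ 2 μ) :=
    { carrier := {f | ∃ ψ, IsTestFun (Set.Ioo a b) ψ ∧ f =ᵐ[μ] deriv ψ}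
      zero_mem' := ⟨fun _ => 0, ⟨contDiff_const, HasCompactSupport.zero, by simp⟩, by
        filter_upwards [Lp.coeFn_zero ℝ 2 μ] with x hx
        exact hx.trans (by simp)⟩
      add_mem' := by
        rintro f f' ⟨ψ, hψ, h⟩ ⟨ψ', hψ', h'⟩
        refine ⟨ψ + ψ', hψ.add hψ', ?_⟩
        filter_upwards [h, h', Lp.coeFn_add f f'] with x h1 h2 h3
        rw [h3, Pi.add_apply, h1, h2, deriv_add (hdiff hψ x) (hdiff hψ' x)]
      smul_mem' := by
        rintro c f ⟨ψ, hψ, h⟩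
        refine ⟨fun x => c * ψ x, hψ.const_mul c, ?_⟩
        filter_upwards [h, Lp.coeFn_smul c f] with x h1 h2
        rw [h2, Pi.smul_apply, h1, deriv_const_mul _ (hdiff hψ x), smul_eq_mul] }
  -- Density by duality: an `m` orthogonal to all derivatives of test functions is constant by du
  -- Bois-Reymond, and constants are orthogonal to the mean-zero `g`.
  have hgS : hg.toLp g ∈ S.topologicalClosure := by
    rw [← Submodule.orthogonal_orthogonal_eq_closure, Submodule.mem_orthogonal]
    intro m hm
    rw [Submodule.mem_orthogonal] at hm
    obtain ⟨c, hc⟩ := ae_eq_const_of_integral_mul_deriv hab (Lp.memLp m) fun χ hχ => by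
      have hd := hχ.isTestFun_deriv.memL2 a b
      have := hm (hd.toLp _) ⟨χ, hχ, hd.coeFn_toLp⟩
      rw [L2.inner_def] at this
      rw [intervalIntegral_eq_integral_Ioo hab.le, ← this]
      refine integral_congr_ae ?_
      filter_upwards [hd.coeFn_toLp] with x h1
      simp [h1]
    rw [L2.inner_def]
    calc ∫ x, (inner ℝ (m x) (hg.toLp g x) : ℝ) ∂μ = ∫ x, c * g x ∂μ := by
          refine integral_congr_ae ?_
          filter_upwards [hg.coeFn_toLp, hc] with x h1 h2
          simp [h1, h2, mul_comm]
      _ = 0 := by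
          rw [integral_const_mul, ← intervalIntegral_eq_integral_Ioo hab.le, h0, mul_zero]
  obtain ⟨w, hw, hlim⟩ := mem_closure_iff_seq_limit.1 hgS
  choose ψ hψ hψw using hw
  refine ⟨ψ, hψ, ?_⟩
  have := (Lp.tendsto_Lp_iff_tendsto_eLpNorm' _ _).1 hlim
  refine this.congr fun k => eLpNorm_congr_ae ?_
  filter_upwards [hψw k, hg.coeFn_toLp] with x h1 h2
  simp [h1, h2]

/-- The primitive of a square integrable function of mean zero belongs to `H¹₀`. -/
theorem hasH10Deriv_of_eq_integral {a b : ℝ} (hab : a < b) {u g : ℝ → ℝ} (hg : MemL2 a b g)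
    (h0 : ∫ x in a..b, g x = 0) (hu : ∀ x ∈ Set.Ioo a b, u x = ∫ y in a..x, g y) :
    HasH10Deriv a b u g := by
  obtain ⟨ψ, hψ, h2⟩ := exists_deriv_testFun_tendsto hab hg h0
  have hgi := hg.intervalIntegrable hab.le
  have huL : MemL2 a b u := by
    have hc : ContinuousOn (fun x => ∫ y in a..x, g y) (Set.Icc a b) := by
      rw [← Set.uIcc_of_le hab.le]
      exact (hgi.absolutelyContinuousOnInterval_intervalIntegral Set.left_mem_uIcc).continuousOn
    exact (memL2_of_continuousOn hc).congr fun x hx => (hu x hx).symm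
  refine ⟨huL, hg, ψ, hψ, ?_, h2⟩
  set μ := volume.restrict (Set.Ioo a b) with hμ
  set K : ENNReal := μ Set.univ with hK
  have hKtop : K ≠ ⊤ := by simp [hK, hμ]
  -- Poincaré's inequality: the supremum of `ψ k - u` is at most the `L¹` norm of the difference of
  -- derivatives. Each of the comparisons `L¹`-`L²` and `L²`-`L^∞` costs a factor `K^{1/2}`, the
  -- square root of the length.
  have hbound : ∀ k, l2Norm a b (fun x => ψ k x - u x) ≤
      K ^ (1 / (2 : ℝ)) * (l2Norm a b (fun x => deriv (ψ k) x - g x) * K ^ (1 / (2 : ℝ))) := by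
    intro k
    have hd : MemL2 a b (fun x => deriv (ψ k) x - g x) := MemLp.sub ((hψ k).isTestFun_deriv.memL2 a b) hg
    have e1 : ∀ x ∈ Set.Ioo a b, ‖ψ k x - u x‖ₑ ≤ eLpNorm (fun x => deriv (ψ k) x - g x) 1 μ := by
      intro x hx
      rw [(hψ k).eq_integral_deriv x, hu x hx, ← intervalIntegral.integral_sub
        ((hψ k).isTestFun_deriv.1.continuous.intervalIntegrable _ _)
        ((hg.mono le_rfl hx.2.le).intervalIntegrable hx.1.le), eLpNorm_one_eq_lintegral_enorm,
        intervalIntegral_eq_integral_Ioo hx.1.le]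
      refine (enorm_integral_le_lintegral_enorm _).trans ?_
      exact lintegral_mono' (Measure.restrict_mono (Set.Ioo_subset_Ioo le_rfl hx.2.le) le_rfl) le_rfl
    have e2 : eLpNorm (fun x => deriv (ψ k) x - g x) 1 μ ≤
        l2Norm a b (fun x => deriv (ψ k) x - g x) * K ^ (1 / (2 : ℝ)) := by
      have := eLpNorm_le_eLpNorm_mul_rpow_measure_univ (p := 1) (q := 2) (by norm_num) hd.1
      have he : (1 / ENNReal.toReal 1 - 1 / ENNReal.toReal 2) = 1 / (2 : ℝ) := by norm_num
      rwa [he] at this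
    have e3 := eLpNorm_le_of_ae_enorm_bound (p := 2) (f := fun x => ψ k x - u x) (μ := μ)
      (C := eLpNorm (fun x => deriv (ψ k) x - g x) 1 μ)
      (by filter_upwards [ae_restrict_mem measurableSet_Ioo] with x hx using e1 x hx)
    refine e3.trans ?_
    rw [smul_eq_mul, mul_comm, ← hK, ENNReal.toReal_ofNat, ← one_div]
    gcongr
  have hlim : Tendsto (fun k => K ^ (1 / (2 : ℝ)) *
      (l2Norm a b (fun x => deriv (ψ k) x - g x) * K ^ (1 / (2 : ℝ)))) atTop (𝓝 0) := by
    have hKp : K ^ (1 / (2 : ℝ)) ≠ ⊤ := ENNReal.rpow_ne_top_of_nonneg (by norm_num) hKtop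
    have := ENNReal.Tendsto.const_mul (a := K ^ (1 / (2 : ℝ)))
      (ENNReal.Tendsto.mul_const (b := K ^ (1 / (2 : ℝ))) h2 (Or.inr hKp)) (Or.inr hKp)
    simpa using this
  exact tendsto_of_tendsto_of_tendsto_of_le_of_le tendsto_const_nhds hlim (fun _ => zero_le) hbound

/-! ### The weak problem in the moving frame, as curves in `L²(0,L)`. -/

theorem MemL2.comp_add_right {a b : ℝ} {f : ℝ → ℝ} (c : ℝ) (hf : MemL2 (a + c) (b + c) f) :
    MemL2 a b (fun x => f (x + c)) := by
  have h := (measurePreserving_add_right volume c).restrict_preimage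
    (measurableSet_Ioo (a := a + c) (b := b + c))
  rw [Set.preimage_add_const_Ioo, add_sub_cancel_right, add_sub_cancel_right] at h
  exact MemLp.comp_measurePreserving hf h

theorem ContL2.memL2 {v L T : ℝ} {f : ℝ → ℝ → ℝ} (h : ContL2 v L T f) {t : ℝ}
    (ht : t ∈ Set.Icc 0 T) : MemL2 0 L (fun η => f (η + v * t) t) := by
  refine MemL2.comp_add_right (v * t) (f := fun x => f x t) ?_
  rw [zero_add]
  exact h.1 t ht

/-- A function in `C([0,T]; L²(I_t))` as a continuous curve in `L²(0,L)`. -/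
theorem ContL2.exists_curve {v L T : ℝ} (hT : 0 ≤ T) {f : ℝ → ℝ → ℝ} (h : ContL2 v L T f) :
    ∃ c : ℝ → Lp ℝ 2 (volume.restrict (Set.Ioo 0 L)), Continuous c ∧
      ∀ t ∈ Set.Icc 0 T, c t =ᵐ[volume.restrict (Set.Ioo 0 L)] fun η => f (η + v * t) t := by
  let c : Set.Icc 0 T → Lp ℝ 2 (volume.restrict (Set.Ioo 0 L)) :=
    fun t => MemLp.toLp _ (h.memL2 t.2)
  have hc : Continuous c := by
    rw [continuous_iff_continuousAt]
    intro s
    refine (Lp.tendsto_Lp_iff_tendsto_eLpNorm'' _ (fun t => h.memL2 t.2) _ (h.memL2 s.2)).2 ?_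
    have := h.2 s s.2
    rw [nhdsWithin_eq_map_subtype_coe s.2, tendsto_map'_iff] at this
    exact this
  -- Freezing the curve outside `[0,T]` makes it continuous on all of `ℝ`, so its primitives are
  -- differentiable everywhere, also at `0` and `T`.
  refine ⟨Set.IccExtend hT c, hc.Icc_extend', fun t ht => ?_⟩
  rw [Set.IccExtend_of_mem hT c ht]
  exact MemLp.coeFn_toLp _

theorem inner_toLp_eq_integral {L : ℝ} (hL : 0 ≤ L) {θ f : ℝ → ℝ} (hθ : MemL2 0 L θ)
    {c : Lp ℝ 2 (volume.restrict (Set.Ioo 0 L))} (hc : c =ᵐ[volume.restrict (Set.Ioo 0 L)] f) :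
    (inner ℝ (hθ.toLp θ) c : ℝ) = ∫ η in (0 : ℝ)..L, f η * θ η := by
  rw [L2.inner_def, intervalIntegral_eq_integral_Ioo hL]
  refine integral_congr_ae ?_
  filter_upwards [hc, hθ.coeFn_toLp] with x h1 h2
  simp [h1, h2]

/-- Products `χ(t) θ(x - vt)` separate the variables in the frame `η = x - vt`, and so reduce the
weak equations to scalar ones in time. The support lies in the image of `tsupport θ ×ˢ tsupport χ`
under the shear back to `(x,t)`. -/
theorem isTestFun_tensor {v L T : ℝ} {θ χ : ℝ → ℝ} (hθ : IsTestFun (Set.Ioo 0 L) θ)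
    (hχ : IsTestFun (Set.Ioo 0 T) χ) :
    IsTestFun (domainQ v L T) (fun p : ℝ × ℝ => χ p.2 * θ (p.1 - v * p.2)) := by
  set K : Set (ℝ × ℝ) := (fun p : ℝ × ℝ => (p.1 + v * p.2, p.2)) '' (tsupport θ ×ˢ tsupport χ)
    with hK
  have hKc : IsCompact K := (hθ.2.1.prod hχ.2.1).image (by fun_prop)
  have hts : tsupport (fun p : ℝ × ℝ => χ p.2 * θ (p.1 - v * p.2)) ⊆ K := by
    refine closure_minimal (fun p hp => ?_) hKc.isClosed
    have hp' : χ p.2 * θ (p.1 - v * p.2) ≠ 0 := hp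
    refine ⟨(p.1 - v * p.2, p.2), ⟨subset_tsupport _ (right_ne_zero_of_mul hp'),
      subset_tsupport _ (left_ne_zero_of_mul hp')⟩, ?_⟩
    ext <;> simp
  refine ⟨?_, hKc.of_isClosed_subset (isClosed_tsupport _) hts, fun p hp => ?_⟩
  · exact (hχ.1.comp contDiff_snd).mul
      (hθ.1.comp (contDiff_fst.sub (contDiff_const.mul contDiff_snd)))
  · obtain ⟨q, ⟨h1, h2⟩, rfl⟩ := hts hp
    have h1' := hθ.2.2 h1
    have h2' := hχ.2.2 h2
    exact ⟨h2'.1, h2'.2, by simpa using h1'.1, by simpa using h1'.2⟩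

theorem dT_tensor {v : ℝ} {θ χ : ℝ → ℝ} (hθ : Differentiable ℝ θ) (hχ : Differentiable ℝ χ)
    (x t : ℝ) : dT (fun p : ℝ × ℝ => χ p.2 * θ (p.1 - v * p.2)) x t =
      deriv χ t * θ (x - v * t) - v * (χ t * deriv θ (x - v * t)) := by
  have h1 : HasDerivAt (fun s => x - v * s) (-v) t := by
    simpa using ((hasDerivAt_id t).const_mul v).const_sub x
  have h2 : HasDerivAt (fun s => χ s * θ (x - v * s)) _ t :=
    (hχ t).hasDerivAt.mul ((hθ (x - v * t)).hasDerivAt.comp t h1)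
  rw [dT, h2.deriv]
  ring

theorem dX_tensor {v : ℝ} {θ χ : ℝ → ℝ} (hθ : Differentiable ℝ θ) (x t : ℝ) :
    dX (fun p : ℝ × ℝ => χ p.2 * θ (p.1 - v * p.2)) x t = χ t * deriv θ (x - v * t) := by
  have h1 : HasDerivAt (fun y => y - v * t) 1 x := (hasDerivAt_id x).sub_const _
  have h2 : HasDerivAt (fun y => χ t * θ (y - v * t)) _ x :=
    ((hθ (x - v * t)).hasDerivAt.comp x h1).const_mul (χ t)
  rw [dX, h2.deriv, mul_one]

theorem integralQ_eq_shift (v L T : ℝ) (F : ℝ → ℝ → ℝ) :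
    integralQ v L T F = ∫ t in (0 : ℝ)..T, ∫ η in (0 : ℝ)..L, F (η + v * t) t := by
  refine intervalIntegral.integral_congr fun t _ => ?_
  rw [intervalIntegral.integral_comp_add_right (fun x => F x t), zero_add]

/-- The data attached to a finite energy solution, as curves in `L²(0,L)`. -/
structure EnergyCurves (v L T : ℝ) (φ φx φt : ℝ → ℝ → ℝ)
    (u x w : ℝ → Lp ℝ 2 (volume.restrict (Set.Ioo 0 L))) : Prop where
  cont_u : Continuous u
  cont_x : Continuous x
  cont_w : Continuous w
  u_eq : ∀ t ∈ Set.Icc 0 T, u t =ᵐ[volume.restrict (Set.Ioo 0 L)] fun η => φ (η + v * t) t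
  x_eq : ∀ t ∈ Set.Icc 0 T, x t =ᵐ[volume.restrict (Set.Ioo 0 L)] fun η => φx (η + v * t) t
  w_eq : ∀ t ∈ Set.Icc 0 T, w t =ᵐ[volume.restrict (Set.Ioo 0 L)] fun η => φt (η + v * t) t

section Weak

variable {v L T : ℝ} {φ φx φt : ℝ → ℝ → ℝ} {u x w : ℝ → Lp ℝ 2 (volume.restrict (Set.Ioo 0 L))}

theorem integralQ_tensor_eq {f : ℝ → ℝ → ℝ} {c : ℝ → Lp ℝ 2 (volume.restrict (Set.Ioo 0 L))}
    (hL : 0 ≤ L) (hT : 0 ≤ T)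
    (hc : ∀ t ∈ Set.Icc 0 T, c t =ᵐ[volume.restrict (Set.Ioo 0 L)] fun η => f (η + v * t) t)
    {θ : ℝ → ℝ} (hθ : MemL2 0 L θ) (χ : ℝ → ℝ) :
    integralQ v L T (fun x t => f x t * (χ t * θ (x - v * t)))
      = ∫ t in (0 : ℝ)..T, inner ℝ (hθ.toLp θ) (c t) * χ t := by
  rw [integralQ_eq_shift]
  refine intervalIntegral.integral_congr fun t ht => ?_
  rw [Set.uIcc_of_le hT] at ht
  rw [inner_toLp_eq_integral hL hθ (hc t ht), ← intervalIntegral.integral_mul_const]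
  refine intervalIntegral.integral_congr fun η _ => ?_
  simp only [add_sub_cancel_right]
  ring

/-- `integralQ` of a sum of products of a moving `L²` function with tensor products. -/
theorem integralQ_tensor_add {f g : ℝ → ℝ → ℝ}
    {c d : ℝ → Lp ℝ 2 (volume.restrict (Set.Ioo 0 L))} (hL : 0 ≤ L) (hT : 0 ≤ T)
    (hcc : Continuous c) (hdc : Continuous d)
    (hc : ∀ t ∈ Set.Icc 0 T, c t =ᵐ[volume.restrict (Set.Ioo 0 L)] fun η => f (η + v * t) t)
    (hd : ∀ t ∈ Set.Icc 0 T, d t =ᵐ[volume.restrict (Set.Ioo 0 L)] fun η => g (η + v * t) t)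
    {θ ζ χ ξ : ℝ → ℝ} (hθ : MemL2 0 L θ) (hζ : MemL2 0 L ζ) (hχ : Continuous χ)
    (hξ : Continuous ξ) :
    integralQ v L T (fun x t => f x t * (χ t * θ (x - v * t)) + g x t * (ξ t * ζ (x - v * t)))
      = (∫ t in (0 : ℝ)..T, inner ℝ (hθ.toLp θ) (c t) * χ t) +
        ∫ t in (0 : ℝ)..T, inner ℝ (hζ.toLp ζ) (d t) * ξ t := by
  have i1 : IntervalIntegrable (fun t => (inner ℝ (hθ.toLp θ) (c t) : ℝ) * χ t) volume 0 T :=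
    ((continuous_const.inner hcc).mul hχ).intervalIntegrable _ _
  have i2 : IntervalIntegrable (fun t => (inner ℝ (hζ.toLp ζ) (d t) : ℝ) * ξ t) volume 0 T :=
    ((continuous_const.inner hdc).mul hξ).intervalIntegrable _ _
  rw [integralQ_eq_shift, ← intervalIntegral.integral_add i1 i2]
  refine intervalIntegral.integral_congr fun t ht => ?_
  rw [Set.uIcc_of_le hT] at ht
  have m1 : MemL2 0 L (fun η => f (η + v * t) t) := (memLp_congr_ae (hc t ht)).1 (Lp.memLp (c t))
  have m2 : MemL2 0 L (fun η => g (η + v * t) t) := (memLp_congr_ae (hd t ht)).1 (Lp.memLp (d t))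
  rw [inner_toLp_eq_integral hL hθ (hc t ht), inner_toLp_eq_integral hL hζ (hd t ht),
    ← intervalIntegral.integral_mul_const, ← intervalIntegral.integral_mul_const,
    ← intervalIntegral.integral_add]
  · refine intervalIntegral.integral_congr fun η _ => ?_
    simp only [add_sub_cancel_right]
    ring
  · exact ((intervalIntegrable_iff_integrableOn_Ioo_of_le hL).2 (m1.integrable_mul hθ)).mul_const _
  · exact ((intervalIntegrable_iff_integrableOn_Ioo_of_le hL).2 (m2.integrable_mul hζ)).mul_const _

/-- The curve `t ↦ φ(· + vt, t)` has derivative `φ_t + v φ_x`. -/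
theorem EnergyCurves.u_eq_add_integral (hL : 0 ≤ L) (hT : 0 < T)
    (hE : EnergyCurves v L T φ φx φt u x w)
    (hH : ∀ t ∈ Set.Icc 0 T,
      HasH10Deriv (v * t) (L + v * t) (fun x => φ x t) (fun x => φx x t))
    (hW : ∀ ψ, IsTestFun (domainQ v L T) ψ →
      integralQ v L T (fun x t => φ x t * dT ψ x t)
        = - integralQ v L T (fun x t => φt x t * ψ (x, t))) :
    ∀ t ∈ Set.Icc 0 T, u t = u 0 + ∫ s in (0 : ℝ)..t, (w s + v • x s) := by
  have hcwx : Continuous fun s => w s + v • x s := hE.cont_w.add (hE.cont_x.const_smul v)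
  have key : ∀ θ, (hθ : IsTestFun (Set.Ioo 0 L) θ) → ∀ t ∈ Set.Icc 0 T,
      (inner ℝ ((hθ.memL2 0 L).toLp θ) (u t) : ℝ) = inner ℝ ((hθ.memL2 0 L).toLp θ) (u 0) +
        ∫ s in (0 : ℝ)..t, (inner ℝ ((hθ.memL2 0 L).toLp θ) (w s + v • x s) : ℝ) := by
    intro θ hθ
    refine eq_add_integral_of_weak_deriv hT (continuous_const.inner hE.cont_u)
      (continuous_const.inner hcwx) fun χ hχ => ?_
    have h := hW _ (isTestFun_tensor (v := v) hθ hχ)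
    have hθd : Differentiable ℝ θ := hθ.1.differentiable (by simp)
    have hχd : Differentiable ℝ χ := hχ.1.differentiable (by simp)
    have h1 := integralQ_tensor_add hL hT.le hE.cont_u hE.cont_u hE.u_eq hE.u_eq
      (hθ.memL2 0 L) (hθ.isTestFun_deriv.memL2 0 L) hχ.isTestFun_deriv.1.continuous
      (ξ := fun t => -v * χ t) (continuous_const.mul hχ.1.continuous)
    have h2 := integralQ_tensor_eq hL hT.le hE.w_eq (hθ.memL2 0 L) χ
    have h3 : integralQ v L T (fun x t => φ x t *
          dT (fun p : ℝ × ℝ => χ p.2 * θ (p.1 - v * p.2)) x t) =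
        integralQ v L T (fun x t => φ x t * (deriv χ t * θ (x - v * t)) +
          φ x t * (-v * χ t * deriv θ (x - v * t))) := by
      congr 1
      funext x t
      rw [dT_tensor hθd hχd]
      ring
    -- The time derivative of the moving test function produces `-v χ θ'`; membership in `H¹₀` moves
    -- this derivative from `θ` onto `φ`, which is where the term `v φx` comes from.
    have h4 : ∀ t ∈ Set.Icc 0 T,
        (inner ℝ ((hθ.isTestFun_deriv.memL2 0 L).toLp (deriv θ)) (u t) : ℝ) =
          -inner ℝ ((hθ.memL2 0 L).toLp θ) (x t) := by
      intro t ht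
      rw [inner_toLp_eq_integral hL _ (hE.u_eq t ht), inner_toLp_eq_integral hL _ (hE.x_eq t ht)]
      have hab : v * t ≤ L + v * t := by linarith
      have := (hH t ht).integral_mul_eq hab (k := fun y => θ (y - v * t))
        (k' := fun y => deriv θ (y - v * t))
        (fun y => by
          have h1 : HasDerivAt (fun y => y - v * t) 1 y := (hasDerivAt_id y).sub_const _
          have h2 := (hθd (y - v * t)).hasDerivAt.comp y h1
          rwa [mul_one] at h2)
        (hθ.isTestFun_deriv.1.continuous.comp (by fun_prop))
      have e1 := intervalIntegral.integral_comp_add_right (a := 0) (b := L)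
        (fun y => φx y t * θ (y - v * t)) (v * t)
      have e2 := intervalIntegral.integral_comp_add_right (a := 0) (b := L)
        (fun y => φ y t * deriv θ (y - v * t)) (v * t)
      simp only [add_sub_cancel_right, zero_add] at e1 e2
      rw [e1, e2, this, neg_neg]
    rw [h3, h1, h2] at h
    have h5 : ∫ t in (0 : ℝ)..T,
          inner ℝ ((hθ.isTestFun_deriv.memL2 0 L).toLp (deriv θ)) (u t) * (-v * χ t) =
        ∫ t in (0 : ℝ)..T, inner ℝ ((hθ.memL2 0 L).toLp θ) (v • x t) * χ t := by
      refine intervalIntegral.integral_congr fun t ht => ?_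
      rw [Set.uIcc_of_le hT.le] at ht
      simp only [h4 t ht, inner_smul_right]
      ring
    have i1 : IntervalIntegrable (fun t => (inner ℝ ((hθ.memL2 0 L).toLp θ) (w t) : ℝ) * χ t)
        volume 0 T := ((continuous_const.inner hE.cont_w).mul hχ.1.continuous).intervalIntegrable _ _
    have i2 : IntervalIntegrable (fun t => (inner ℝ ((hθ.memL2 0 L).toLp θ) (v • x t) : ℝ) * χ t)
        volume 0 T := ((continuous_const.inner
          (hE.cont_x.const_smul v)).mul hχ.1.continuous).intervalIntegrable _ _
    simp only [inner_add_right, add_mul]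
    rw [intervalIntegral.integral_add i1 i2]
    rw [h5] at h
    linarith
  intro t ht
  rw [← sub_eq_zero]
  set m := u t - (u 0 + ∫ s in (0 : ℝ)..t, (w s + v • x s)) with hm
  -- The scalar identities hold for every test function `θ`, and these separate the elements of
  -- `L²(0,L)`.
  have hz : ∀ᵐ η ∂(volume.restrict (Set.Ioo 0 L)), m η = 0 := by
    refine ae_eq_zero_of_integral_testFun hL (Lp.memLp m) fun χ hχ => ?_
    rw [← inner_toLp_eq_integral hL (hχ.memL2 0 L) (c := m) (Filter.EventuallyEq.refl _ _), hm,
      inner_sub_right, inner_add_right, key χ hχ t ht]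
    have := (innerSL ℝ ((hχ.memL2 0 L).toLp χ)).intervalIntegral_comp_comm
      (hcwx.intervalIntegrable 0 t) (μ := volume)
    simp only [innerSL_apply_apply] at this
    rw [this, sub_self]
  exact (Lp.eq_zero_iff_ae_eq_zero).2 hz

/-- The weak wave equation in the moving frame, tested against an element of `H¹₀(0,L)`. -/
theorem EnergyCurves.integral_w_mul_eq (hL : 0 ≤ L) (hT : 0 < T)
    (hE : EnergyCurves v L T φ φx φt u x w)
    (hW : ∀ ψ, IsTestFun (domainQ v L T) ψ →
      integralQ v L T (fun x t => φt x t * dT ψ x t - φx x t * dX ψ x t) = 0)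
    {θ θ' : ℝ → ℝ} (hθ : HasH10Deriv 0 L θ θ') :
    ∀ t ∈ Set.Icc 0 T, (inner ℝ (hθ.1.toLp θ) (w t) : ℝ) = inner ℝ (hθ.1.toLp θ) (w 0) -
      inner ℝ (hθ.2.1.toLp θ') (∫ s in (0 : ℝ)..t, (v • w s + x s)) := by
  have hcwx : Continuous fun s => v • w s + x s := (hE.cont_w.const_smul v).add hE.cont_x
  have key : ∀ θ, (hθ : IsTestFun (Set.Ioo 0 L) θ) → ∀ t ∈ Set.Icc 0 T,
      (inner ℝ ((hθ.memL2 0 L).toLp θ) (w t) : ℝ) = inner ℝ ((hθ.memL2 0 L).toLp θ) (w 0) +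
        ∫ s in (0 : ℝ)..t,
          -(inner ℝ ((hθ.isTestFun_deriv.memL2 0 L).toLp (deriv θ)) (v • w s + x s) : ℝ) := by
    intro θ hθ
    refine eq_add_integral_of_weak_deriv hT (continuous_const.inner hE.cont_w)
      (continuous_const.inner hcwx).neg fun χ hχ => ?_
    have h := hW _ (isTestFun_tensor (v := v) hθ hχ)
    have hθd : Differentiable ℝ θ := hθ.1.differentiable (by simp)
    have hχd : Differentiable ℝ χ := hχ.1.differentiable (by simp)
    have hwx : ∀ t ∈ Set.Icc 0 T, (v • w t + x t : Lp ℝ 2 (volume.restrict (Set.Ioo 0 L)))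
        =ᵐ[volume.restrict (Set.Ioo 0 L)]
        fun η => (fun y s => v * φt y s + φx y s) (η + v * t) t := by
      intro t ht
      filter_upwards [Lp.coeFn_add (v • w t) (x t), Lp.coeFn_smul v (w t), hE.w_eq t ht,
        hE.x_eq t ht] with η h1 h2 h3 h4
      rw [h1, Pi.add_apply, h2, Pi.smul_apply, h3, h4, smul_eq_mul]
    have h1 := integralQ_tensor_add hL hT.le hE.cont_w hcwx hE.w_eq
      (g := fun y s => v * φt y s + φx y s) hwx
      (hθ.memL2 0 L) (hθ.isTestFun_deriv.memL2 0 L) hχ.isTestFun_deriv.1.continuous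
      (ξ := fun t => -χ t) hχ.1.continuous.neg
    have h3 : integralQ v L T (fun x t =>
          φt x t * dT (fun p : ℝ × ℝ => χ p.2 * θ (p.1 - v * p.2)) x t -
          φx x t * dX (fun p : ℝ × ℝ => χ p.2 * θ (p.1 - v * p.2)) x t) =
        integralQ v L T (fun x t => φt x t * (deriv χ t * θ (x - v * t)) +
          (v * φt x t + φx x t) * (-χ t * deriv θ (x - v * t))) := by
      congr 1
      funext x t
      rw [dT_tensor hθd hχd, dX_tensor hθd]
      ring
    rw [h3, h1] at h
    simp only [mul_neg, neg_mul, intervalIntegral.integral_neg] at h ⊢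
    linarith
  intro t ht
  -- From test functions to `H¹₀`: at fixed `t` the identity involves only `L²` pairings of `θ` and
  -- `θ'`, so it survives the limit defining `HasH10Deriv`.
  obtain ⟨hθ1, hθ2, ψ, hψ, l1, l2⟩ := hθ
  set m := w t - w 0 with hm
  set Y := ∫ s in (0 : ℝ)..t, (v • w s + x s) with hY
  have t1 := tendsto_integral_mul hL (fun i => (hψ i).memL2 0 L) hθ1 (Lp.memLp m) l1
  have t2 := tendsto_integral_mul hL (fun i => (hψ i).isTestFun_deriv.memL2 0 L) hθ2
    (Lp.memLp Y) l2
  have e : ∀ i, ∫ η in (0 : ℝ)..L, ψ i η * m η = -∫ η in (0 : ℝ)..L, deriv (ψ i) η * Y η := by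
    intro i
    have k := key (ψ i) (hψ i) t ht
    have := (innerSL ℝ (((hψ i).isTestFun_deriv.memL2 0 L).toLp (deriv (ψ i)))
      ).intervalIntegral_comp_comm (hcwx.intervalIntegrable 0 t) (μ := volume)
    simp only [innerSL_apply_apply] at this
    rw [intervalIntegral.integral_neg, this, ← hY] at k
    have a1 := inner_toLp_eq_integral hL ((hψ i).memL2 0 L) (c := m) (Filter.EventuallyEq.refl _ _)
    have a2 := inner_toLp_eq_integral hL ((hψ i).isTestFun_deriv.memL2 0 L) (c := Y)
      (Filter.EventuallyEq.refl _ _)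
    rw [hm, inner_sub_right, ← hm] at a1
    simp only [mul_comm (ψ i _), mul_comm (deriv (ψ i) _)]
    rw [← a1, ← a2]
    linarith
  have lim := tendsto_nhds_unique t1 (t2.neg.congr fun i => (e i).symm)
  have a1 := inner_toLp_eq_integral hL hθ1 (c := m) (Filter.EventuallyEq.refl _ _)
  have a2 := inner_toLp_eq_integral hL hθ2 (c := Y) (Filter.EventuallyEq.refl _ _)
  rw [hm, inner_sub_right, ← hm] at a1
  simp only [mul_comm (θ _), mul_comm (θ' _)] at lim
  rw [← a1, ← a2] at lim
  linarith

end Weak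

/-! ### Pairings with complex modes and the conservation law. -/

theorem l2Norm_comp_add_right {a b : ℝ} {f : ℝ → ℝ} (c : ℝ) (hf : MemL2 (a + c) (b + c) f) :
    l2Norm a b (fun x => f (x + c)) = l2Norm (a + c) (b + c) f := by
  have h := (measurePreserving_add_right volume c).restrict_preimage
    (measurableSet_Ioo (a := a + c) (b := b + c))
  rw [Set.preimage_add_const_Ioo, add_sub_cancel_right, add_sub_cancel_right] at h
  exact eLpNorm_comp_measurePreserving hf.1 h

theorem IsTestFun.comp_add_right {a b : ℝ} {ψ : ℝ → ℝ} (c : ℝ)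
    (h : IsTestFun (Set.Ioo (a + c) (b + c)) ψ) : IsTestFun (Set.Ioo a b) (fun x => ψ (x + c)) := by
  refine ⟨h.1.comp (contDiff_id.add contDiff_const),
    h.2.1.comp_homeomorph (Homeomorph.addRight c), fun x hx => ?_⟩
  have h1 : x + c ∈ tsupport ψ :=
    tsupport_comp_subset_preimage ψ (f := fun x => x + c) (by fun_prop) hx
  have h2 := h.2.2 h1
  exact ⟨by linarith [h2.1], by linarith [h2.2]⟩

theorem HasH10Deriv.comp_add_right {a b : ℝ} {u g : ℝ → ℝ} (c : ℝ)
    (h : HasH10Deriv (a + c) (b + c) u g) :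
    HasH10Deriv a b (fun x => u (x + c)) (fun x => g (x + c)) := by
  obtain ⟨hu, hg, ψ, hψ, h1, h2⟩ := h
  refine ⟨hu.comp_add_right c, hg.comp_add_right c, fun k x => ψ k (x + c),
    fun k => (hψ k).comp_add_right c, ?_, ?_⟩
  · refine h1.congr fun k => ?_
    exact (l2Norm_comp_add_right c (MemLp.sub ((hψ k).memL2 _ _) hu)).symm
  · refine h2.congr fun k => ?_
    simp only [deriv_comp_add_const]
    exact (l2Norm_comp_add_right c (MemLp.sub ((hψ k).isTestFun_deriv.memL2 _ _) hg)).symm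

/-- A continuously differentiable function vanishing at both endpoints belongs to `H¹₀`. -/
theorem hasH10Deriv_of_hasDerivAt {a b : ℝ} (hab : a < b) {k k' : ℝ → ℝ}
    (hk : ∀ x, HasDerivAt k (k' x) x) (hk' : Continuous k') (ha : k a = 0) (hb : k b = 0) :
    HasH10Deriv a b k k' := by
  have h : ∀ x, ∫ y in a..x, k' y = k x := fun x => by
    rw [intervalIntegral.integral_eq_sub_of_hasDerivAt (fun y _ => hk y)
      (hk'.intervalIntegrable _ _), ha, sub_zero]
  exact hasH10Deriv_of_eq_integral hab (memL2_of_continuousOn hk'.continuousOn)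
    ((h b).trans hb) fun x _ => (h x).symm

theorem HasH10Deriv.integral_mul_eq_complex {a b : ℝ} (hab : a ≤ b) {u g : ℝ → ℝ} {k k' : ℝ → ℂ}
    (h : HasH10Deriv a b u g) (hk : ∀ x, HasDerivAt k (k' x) x) (hk' : Continuous k') :
    ∫ x in a..b, (g x : ℂ) * k x = -∫ x in a..b, (u x : ℂ) * k' x := by
  have hkc : Continuous k := continuous_iff_continuousAt.2 fun x => (hk x).continuousAt
  rw [intervalIntegral_ofReal_mul (h.2.1.intervalIntegrable hab) hkc,
    intervalIntegral_ofReal_mul (h.1.intervalIntegrable hab) hk',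
    h.integral_mul_eq hab (k := fun x => (k x).re) (k' := fun x => (k' x).re)
      (fun x => Complex.reCLM.hasFDerivAt.comp_hasDerivAt x (hk x))
      (Complex.continuous_re.comp hk'),
    h.integral_mul_eq hab (k := fun x => (k x).im) (k' := fun x => (k' x).im)
      (fun x => Complex.imCLM.hasFDerivAt.comp_hasDerivAt x (hk x))
      (Complex.continuous_im.comp hk')]
  push_cast
  ring

section Pairing

variable {L : ℝ}

/-- The pairing `c ↦ ∫₀ᴸ c k` of `L²(0,L)` with a continuous complex valued function. -/
noncomputable def pairing (k : ℝ → ℂ) (hk : Continuous k) :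
    Lp ℝ 2 (volume.restrict (Set.Ioo 0 L)) →L[ℝ] ℂ :=
  Complex.ofRealCLM.comp (innerSL ℝ (MemLp.toLp (fun η => (k η).re)
      (memL2_of_continuousOn (Complex.continuous_re.comp hk).continuousOn))) +
    Complex.I • Complex.ofRealCLM.comp (innerSL ℝ (MemLp.toLp (fun η => (k η).im)
      (memL2_of_continuousOn (Complex.continuous_im.comp hk).continuousOn)))

theorem pairing_eq (hL : 0 ≤ L) {k : ℝ → ℂ} (hk : Continuous k) {f : ℝ → ℝ}
    {c : Lp ℝ 2 (volume.restrict (Set.Ioo 0 L))} (hc : c =ᵐ[volume.restrict (Set.Ioo 0 L)] f) :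
    pairing k hk c = ∫ η in (0 : ℝ)..L, (f η : ℂ) * k η := by
  have hf : MemL2 0 L f := (memLp_congr_ae hc).1 (Lp.memLp c)
  rw [intervalIntegral_ofReal_mul (hf.intervalIntegrable hL) hk,
    ← inner_toLp_eq_integral hL (θ := fun η => (k η).re) (memL2_of_continuousOn
      (Complex.continuous_re.comp hk).continuousOn) hc,
    ← inner_toLp_eq_integral hL (θ := fun η => (k η).im) (memL2_of_continuousOn
      (Complex.continuous_im.comp hk).continuousOn) hc]
  simp [pairing, mul_comm]

/-- The pairing involves no conjugation, so it is `ℂ`-linear in the kernel, although the states are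
real and it is only `ℝ`-linear in them. -/
theorem pairing_linear (hL : 0 ≤ L) {k k₁ k₂ : ℝ → ℂ} (hk : Continuous k) (hk₁ : Continuous k₁)
    (hk₂ : Continuous k₂) (α β : ℂ) (h : ∀ η, k η = α * k₁ η + β * k₂ η)
    (c : Lp ℝ 2 (volume.restrict (Set.Ioo 0 L))) :
    pairing k hk c = α * pairing k₁ hk₁ c + β * pairing k₂ hk₂ c := by
  have hc : MemL2 0 L c := Lp.memLp c
  have hci : IntervalIntegrable (fun η => ((c η : ℝ) : ℂ)) volume 0 L :=
    ⟨Integrable.ofReal (hc.intervalIntegrable hL).1, Integrable.ofReal (hc.intervalIntegrable hL).2⟩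
  rw [pairing_eq hL hk (Filter.EventuallyEq.refl _ _),
    pairing_eq hL hk₁ (Filter.EventuallyEq.refl _ _),
    pairing_eq hL hk₂ (Filter.EventuallyEq.refl _ _), ← intervalIntegral.integral_const_mul,
    ← intervalIntegral.integral_const_mul, ← intervalIntegral.integral_add
      ((hci.mul_continuousOn hk₁.continuousOn).const_mul _)
      ((hci.mul_continuousOn hk₂.continuousOn).const_mul _)]
  refine intervalIntegral.integral_congr fun η _ => ?_
  simp only [h η]
  ring

end Pairing

section Conservation

variable {v L T : ℝ} {φ φx φt : ℝ → ℝ → ℝ} {u x w : ℝ → Lp ℝ 2 (volume.restrict (Set.Ioo 0 L))}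

/-- The curve `x` is merely continuous in time, whereas `u` is a primitive in time; this trade makes
the pairing with `x` differentiable. The kernel need not vanish at the endpoints. -/
theorem EnergyCurves.pairing_x_eq (hL : 0 ≤ L) (hE : EnergyCurves v L T φ φx φt u x w)
    (hH : ∀ t ∈ Set.Icc 0 T,
      HasH10Deriv (v * t) (L + v * t) (fun x => φ x t) (fun x => φx x t))
    {k k' : ℝ → ℂ} (hk : ∀ x, HasDerivAt k (k' x) x) (hkc : Continuous k) (hk' : Continuous k')
    {t : ℝ} (ht : t ∈ Set.Icc 0 T) :
    pairing k hkc (x t) = -pairing k' hk' (u t) := by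
  rw [pairing_eq hL hkc (hE.x_eq t ht), pairing_eq hL hk' (hE.u_eq t ht)]
  refine HasH10Deriv.integral_mul_eq_complex hL ?_ hk hk'
  refine HasH10Deriv.comp_add_right (v * t) (u := fun x => φ x t) (g := fun x => φx x t) ?_
  rw [zero_add]
  exact hH t ht

/-- Here the kernel must vanish at `0` and `L`, since the wave equation may only be tested with
elements of `H¹₀`. -/
theorem EnergyCurves.pairing_w_eq (hL : 0 < L) (hT : 0 < T)
    (hE : EnergyCurves v L T φ φx φt u x w)
    (hW : ∀ ψ, IsTestFun (domainQ v L T) ψ →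
      integralQ v L T (fun x t => φt x t * dT ψ x t - φx x t * dX ψ x t) = 0)
    {k k' : ℝ → ℂ} (hk : ∀ x, HasDerivAt k (k' x) x) (hkc : Continuous k) (hk' : Continuous k')
    (h0 : k 0 = 0) (h1 : k L = 0) {t : ℝ} (ht : t ∈ Set.Icc 0 T) :
    pairing k hkc (w t) = pairing k hkc (w 0) -
      pairing k' hk' (∫ s in (0 : ℝ)..t, (v • w s + x s)) := by
  have hre := hasH10Deriv_of_hasDerivAt hL (k := fun x => (k x).re) (k' := fun x => (k' x).re)
      (fun x => Complex.reCLM.hasFDerivAt.comp_hasDerivAt x (hk x))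
      (Complex.continuous_re.comp hk') (by simp [h0]) (by simp [h1])
  have him := hasH10Deriv_of_hasDerivAt hL (k := fun x => (k x).im) (k' := fun x => (k' x).im)
      (fun x => Complex.imCLM.hasFDerivAt.comp_hasDerivAt x (hk x))
      (Complex.continuous_im.comp hk') (by simp [h0]) (by simp [h1])
  have e1 := hE.integral_w_mul_eq hL.le hT hW hre t ht
  have e2 := hE.integral_w_mul_eq hL.le hT hW him t ht
  simp only [pairing, add_apply, smul_apply,
    ContinuousLinearMap.comp_apply, innerSL_apply_apply, Complex.ofRealCLM_apply, smul_eq_mul]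
  rw [e1, e2]
  push_cast
  ring

theorem hasDerivAt_cexp_mul (c : ℂ) (η : ℝ) :
    HasDerivAt (fun η : ℝ => Complex.exp (c * η)) (c * Complex.exp (c * η)) η := by
  have h1 : HasDerivAt (fun η : ℝ => c * (η : ℂ)) c η := by
    simpa using (Complex.ofRealCLM.hasDerivAt (x := η)).const_mul c
  simpa [mul_comm] using h1.cexp

/-- The conserved quantity attached to the separated solution
`e^{μ(1-v²)t} (e^{μ(1-v)η} - e^{-μ(1+v)η})` of the wave equation in the moving frame. -/
theorem EnergyCurves.conservation (hL : 0 < L) (hT : 0 < T)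
    (hE : EnergyCurves v L T φ φx φt u x w)
    (hH : ∀ t ∈ Set.Icc 0 T,
      HasH10Deriv (v * t) (L + v * t) (fun x => φ x t) (fun x => φx x t))
    (hW : ∀ ψ, IsTestFun (domainQ v L T) ψ →
      integralQ v L T (fun x t => φ x t * dT ψ x t)
        = - integralQ v L T (fun x t => φt x t * ψ (x, t)))
    (hW' : ∀ ψ, IsTestFun (domainQ v L T) ψ →
      integralQ v L T (fun x t => φt x t * dT ψ x t - φx x t * dX ψ x t) = 0)
    {μ : ℂ} (hμ : Complex.exp (μ * (1 - v) * L) = Complex.exp (-(μ * (1 + v)) * L))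
    {θ κ : ℝ → ℂ} (hθc : Continuous θ) (hκc : Continuous κ)
    (hθ : ∀ η : ℝ, θ η = Complex.exp (μ * (1 - v) * η) - Complex.exp (-(μ * (1 + v)) * η))
    (hκ : ∀ η : ℝ, κ η = Complex.exp (μ * (1 - v) * η) + Complex.exp (-(μ * (1 + v)) * η))
    {t : ℝ} (ht : t ∈ Set.Icc 0 T) :
    Complex.exp (μ * (1 - v ^ 2) * t) * (pairing θ hθc (w t) + pairing κ hκc (x t)) =
      pairing θ hθc (w 0) + pairing κ hκc (x 0) := by
  set ρ : ℂ := μ * (1 - v ^ 2) with hρ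
  set θ' : ℝ → ℂ := fun η => μ * (1 - v) * Complex.exp (μ * (1 - v) * η) -
    -(μ * (1 + v)) * Complex.exp (-(μ * (1 + v)) * η) with hθ'
  set κ' : ℝ → ℂ := fun η => μ * (1 - v) * Complex.exp (μ * (1 - v) * η) +
    -(μ * (1 + v)) * Complex.exp (-(μ * (1 + v)) * η) with hκ'
  have hθd : ∀ η, HasDerivAt θ (θ' η) η := by
    rw [funext hθ]
    exact fun η => (hasDerivAt_cexp_mul _ η).sub (hasDerivAt_cexp_mul _ η)
  have hκd : ∀ η, HasDerivAt κ (κ' η) η := by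
    rw [funext hκ]
    exact fun η => (hasDerivAt_cexp_mul _ η).add (hasDerivAt_cexp_mul _ η)
  have hθ'c : Continuous θ' := by fun_prop
  have hκ'c : Continuous κ' := by fun_prop
  have hwx : Continuous fun s => w s + v • x s := hE.cont_w.add (hE.cont_x.const_smul v)
  have hxw : Continuous fun s => v • w s + x s := (hE.cont_w.const_smul v).add hE.cont_x
  -- `r1` and `r2` rest on `κ' + vθ' = ρθ` and `θ' + vκ' = ρκ`: the pair `(θ, κ)` is an eigenvector,
  -- with eigenvalue `ρ`, of the adjoint of the evolution in the moving frame.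
  have r1 : ∀ c : Lp ℝ 2 (volume.restrict (Set.Ioo 0 L)),
      pairing κ' hκ'c c = ρ * pairing θ hθc c + -(v : ℂ) * pairing θ' hθ'c c := by
    refine pairing_linear hL.le _ _ _ _ _ fun η => ?_
    simp only [hθ, hκ', hθ', hρ]
    ring
  have r2 : ∀ c : Lp ℝ 2 (volume.restrict (Set.Ioo 0 L)),
      pairing θ' hθ'c c = ρ * pairing κ hκc c + -(v : ℂ) * pairing κ' hκ'c c := by
    refine pairing_linear hL.le _ _ _ _ _ fun η => ?_
    simp only [hκ, hκ', hθ', hρ]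
    ring
  -- The quantity is written through time primitives, so that it is differentiable on all of `ℝ`; on
  -- `[0,T]` it agrees with the pairings of `w` and `x`.
  set G : ℝ → ℂ := fun s => Complex.exp (ρ * s) *
    (pairing θ hθc (w 0) - pairing θ' hθ'c (∫ s in (0 : ℝ)..s, (v • w s + x s)) -
      pairing κ' hκ'c (u 0 + ∫ s in (0 : ℝ)..s, (w s + v • x s))) with hG
  have hGE : ∀ s ∈ Set.Icc 0 T, G s =
      Complex.exp (ρ * s) * (pairing θ hθc (w s) + pairing κ hκc (x s)) := by
    intro s hs
    rw [hE.pairing_w_eq hL hT hW' hθd hθc hθ'c (by simp [hθ]) (by simp [hθ, hμ]) hs,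
      hE.pairing_x_eq hL.le hH hκd hκc hκ'c hs, hE.u_eq_add_integral hL.le hT hH hW s hs, hG]
    ring
  have hGd : ∀ s : ℝ, HasDerivAt G (ρ * Complex.exp (ρ * s) *
      (pairing θ hθc (w 0) - pairing θ' hθ'c (∫ s in (0 : ℝ)..s, (v • w s + x s)) -
        pairing κ' hκ'c (u 0 + ∫ s in (0 : ℝ)..s, (w s + v • x s))) + Complex.exp (ρ * s) *
      (0 - pairing θ' hθ'c (v • w s + x s) - pairing κ' hκ'c (w s + v • x s))) s := by
    intro s
    have d1 : HasDerivAt (fun s => ∫ s in (0 : ℝ)..s, (v • w s + x s)) (v • w s + x s) s :=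
      intervalIntegral.integral_hasDerivAt_right (hxw.intervalIntegrable _ _)
        hxw.stronglyMeasurable.stronglyMeasurableAtFilter hxw.continuousAt
    have d2 : HasDerivAt (fun s => ∫ s in (0 : ℝ)..s, (w s + v • x s)) (w s + v • x s) s :=
      intervalIntegral.integral_hasDerivAt_right (hwx.intervalIntegrable _ _)
        hwx.stronglyMeasurable.stronglyMeasurableAtFilter hwx.continuousAt
    have d3 := (pairing θ' hθ'c).hasFDerivAt.comp_hasDerivAt s d1
    have d4 := (pairing κ' hκ'c).hasFDerivAt.comp_hasDerivAt s (d2.const_add (u 0))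
    exact (hasDerivAt_cexp_mul ρ s).mul (((hasDerivAt_const s _).sub d3).sub d4)
  have hG0 : ∀ s ∈ Set.Icc 0 T, HasDerivAt G 0 s := by
    intro s hs
    convert hGd s using 1
    have e := hGE s hs
    simp only [hG] at e
    have e' : (pairing θ hθc (w 0) - pairing θ' hθ'c (∫ s in (0 : ℝ)..s, (v • w s + x s)) -
        pairing κ' hκ'c (u 0 + ∫ s in (0 : ℝ)..s, (w s + v • x s))) =
          pairing θ hθc (w s) + pairing κ hκc (x s) := mul_left_cancel₀ (Complex.exp_ne_zero _) e
    rw [e']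
    simp only [map_add, map_smul, Complex.real_smul]
    have q1 := r1 (w s)
    have q2 := r2 (x s)
    -- The sum of pairings has time derivative `-(w, vθ' + κ') - (x, θ' + vκ')`, which is `-ρ` times
    -- itself by `r1` and `r2`; the factor `e^{ρs}` compensates for it.
    linear_combination (Complex.exp (ρ * s)) * q1 + (Complex.exp (ρ * s)) * q2
  have hconst := constant_of_has_deriv_right_zero (f := G) (a := 0) (b := T)
    (fun s _ => (hGd s).continuousAt.continuousWithinAt)
    (fun s hs => (hG0 s (Set.Ico_subset_Icc_self hs)).hasDerivWithinAt) t ht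
  rw [← hGE t ht, hconst, hGE 0 (Set.left_mem_Icc.2 hT.le)]
  simp

end Conservation

/-! ### Affine substitutions, periodic functions and the Fourier series of a primitive. -/

theorem map_restrict_affine {c : ℝ} (hc : c ≠ 0) (d : ℝ) (s : Set ℝ) :
    Measure.map (fun x => c * x + d) (volume.restrict ((fun x => c * x + d) ⁻¹' s)) =
      ENNReal.ofReal |c⁻¹| • volume.restrict s := by
  have he : MeasurableEmbedding (fun x : ℝ => c * x + d) :=
    ((Homeomorph.mulLeft₀ c hc).trans (Homeomorph.addRight d)).measurableEmbedding
  rw [← he.restrict_map]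
  have h : Measure.map (fun x : ℝ => c * x + d) volume = ENNReal.ofReal |c⁻¹| • volume := by
    have : (fun x : ℝ => c * x + d) = (fun x => x + d) ∘ (fun x => c * x) := rfl
    rw [this, ← Measure.map_map (measurable_add_const d) (measurable_const_mul c),
      Real.map_volume_mul_left hc, Measure.map_smul, map_add_right_eq_self]
  rw [h, Measure.restrict_smul]

theorem memLp_comp_affine {c : ℝ} (hc : c ≠ 0) (d : ℝ) {s : Set ℝ} {f : ℝ → ℝ}
    (hf : MemLp f 2 (volume.restrict s)) :
    MemLp (fun x => f (c * x + d)) 2 (volume.restrict ((fun x => c * x + d) ⁻¹' s)) := by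
  refine MemLp.comp_of_map (g := f) ?_ (by fun_prop)
  rw [map_restrict_affine hc d s]
  exact hf.smul_measure ENNReal.ofReal_ne_top

theorem MemL2.comp_affine {c : ℝ} (hc : c ≠ 0) (d : ℝ) {f : ℝ → ℝ} (hf : ∀ a b, MemL2 a b f)
    (a b : ℝ) : MemL2 a b (fun x => f (c * x + d)) := by
  have h := memLp_comp_affine hc d (hf (min (c * a + d) (c * b + d)) (max (c * a + d) (c * b + d)))
  refine h.mono_measure (Measure.restrict_mono (fun x hx => ?_) le_rfl)
  rcases lt_or_gt_of_ne hc with h0 | h0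
  · exact ⟨(min_le_right _ _).trans_lt (by nlinarith [hx.2]),
      (show c * x + d < c * a + d by nlinarith [hx.1]).trans_le (le_max_left _ _)⟩
  · exact ⟨(min_le_left _ _).trans_lt (by nlinarith [hx.1]),
      (show c * x + d < c * b + d by nlinarith [hx.2]).trans_le (le_max_right _ _)⟩

theorem intervalIntegrable_of_memL2 {f : ℝ → ℝ} (hf : ∀ a b, MemL2 a b f) (a b : ℝ) :
    IntervalIntegrable f volume a b := by
  rcases le_total a b with h | h
  · exact (hf a b).intervalIntegrable h
  · exact ((hf b a).intervalIntegrable h).symm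

/-- Square integrability on a period implies local square integrability. -/
theorem memL2_of_periodic {P a : ℝ} (hP : 0 < P) {f : ℝ → ℝ} (hp : Function.Periodic f P)
    (hf : MemL2 a (a + P) f) (b c : ℝ) : MemL2 b c f := by
  rcases le_total c b with hbc | hbc
  · rw [MemL2, Set.Ioo_eq_empty (not_lt.2 hbc)]
    simp
  have haP : a ≤ a + P := by linarith
  have h1 := hp.intervalIntegrable hP.ne' (hf.intervalIntegrable haP) b c
  -- Integrability spreads from one period to every interval; applied to `f` and to `f²` it gives
  -- square integrability.
  have h2 : IntervalIntegrable (fun x => f x ^ 2) volume b c := by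
    refine Function.Periodic.intervalIntegrable (f := fun x => f x ^ 2) (hp.comp (· ^ 2)) hP.ne'
      (t := a) ?_ b c
    exact (intervalIntegrable_iff_integrableOn_Ioo_of_le haP).2
      ((memLp_two_iff_integrable_sq hf.1).1 hf)
  rw [intervalIntegrable_iff_integrableOn_Ioo_of_le hbc] at h1 h2
  exact (memLp_two_iff_integrable_sq h1.aestronglyMeasurable).2 h2

theorem periodic_primitive {P : ℝ} {f : ℝ → ℝ} (hp : Function.Periodic f P)
    (hf : ∀ a b, IntervalIntegrable f volume a b) (h0 : ∫ x in (0 : ℝ)..P, f x = 0) :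
    Function.Periodic (fun y => ∫ x in (0 : ℝ)..y, f x) P := by
  intro y
  have h := hp.intervalIntegral_add_eq y 0
  rw [zero_add, h0] at h
  simp only
  rw [← intervalIntegral.integral_add_adjacent_intervals (hf 0 y) (hf y (y + P)), h, add_zero]

/-- The Fourier series of the primitive of a periodic, locally square integrable function. -/
theorem exists_hasSum_fourier_primitive {P : ℝ} (hP : 0 < P) {f : ℝ → ℝ}
    (hp : Function.Periodic f P) (hf : ∀ a b, MemL2 a b f) (h0 : ∫ x in (0 : ℝ)..P, f x = 0) :
    ∃ C : ℤ → ℂ,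
      (∀ n : ℤ, n ≠ 0 → C n = 1 / (2 * Real.pi * Complex.I * n) *
        ∫ x in (0 : ℝ)..P, (f x : ℂ) * Complex.exp (-(2 * Real.pi * Complex.I * n * x / P))) ∧
      ∀ y : ℝ, HasSum (fun n : ℤ => C n * Complex.exp (2 * Real.pi * Complex.I * n * y / P))
        ((∫ x in (0 : ℝ)..y, f x : ℝ) : ℂ) := by
  have : Fact (0 < P) := ⟨hP⟩
  have hPC : (P : ℂ) ≠ 0 := by exact_mod_cast hP.ne'
  have hpi : (Real.pi : ℂ) ≠ 0 := by exact_mod_cast Real.pi_ne_zero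
  have hii := intervalIntegrable_of_memL2 hf
  set F : ℝ → ℝ := fun y => ∫ x in (0 : ℝ)..y, f x with hF
  have hFp : Function.Periodic F P := periodic_primitive hp hii h0
  have hFc : Continuous F := intervalIntegral.continuous_primitive hii 0
  have hFCp : Function.Periodic (fun y => (F y : ℂ)) P :=
    hFp.comp (fun y : ℝ => (y : ℂ))
  let FC : C(AddCircle P, ℂ) := ⟨hFCp.lift,
    (Complex.continuous_ofReal.comp hFc).quotient_lift _⟩
  have hFC : ∀ y : ℝ, FC (y : AddCircle P) = F y := fun y => hFCp.lift_coe y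
  set a : ℤ → ℂ := fun n =>
    ∫ x in (0 : ℝ)..P, (f x : ℂ) * Complex.exp (-(2 * Real.pi * Complex.I * n * x / P)) with ha
  -- Integration by parts gains the factor `1/n`; there is no boundary term because `F 0 = F P = 0`.
  have hcoef : ∀ n : ℤ, n ≠ 0 →
      fourierCoeff FC n = 1 / (2 * Real.pi * Complex.I * n) * a n := by
    intro n hn
    have hnC : (n : ℂ) ≠ 0 := by exact_mod_cast hn
    set m : ℂ := -(2 * Real.pi * Complex.I * n / P) with hm
    have hm0 : m ≠ 0 := by
      rw [hm, neg_ne_zero]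
      exact div_ne_zero (mul_ne_zero (mul_ne_zero (mul_ne_zero two_ne_zero hpi) Complex.I_ne_zero)
        hnC) hPC
    have hkd : ∀ x : ℝ, HasDerivAt (fun x : ℝ => m⁻¹ * Complex.exp (m * x)) (Complex.exp (m * x)) x := by
      intro x
      have h2 := (hasDerivAt_cexp_mul m x).const_mul m⁻¹
      rwa [inv_mul_cancel_left₀ hm0] at h2
    have hbp := integral_primitive_mul_deriv_complex (a := 0) (b := P) (c := 0) Set.left_mem_uIcc
      (hii 0 P) 0 (F := F) (fun x _ => (zero_add _).symm) hkd (by fun_prop)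
    have hFP : F P = 0 := h0
    have hF0 : F 0 = 0 := intervalIntegral.integral_same
    rw [hFP, hF0] at hbp
    rw [fourierCoeff_eq_intervalIntegral FC n 0, zero_add]
    have e1 : ∫ x in (0 : ℝ)..P, fourier (-n) (x : AddCircle P) • FC (x : AddCircle P) =
        ∫ x in (0 : ℝ)..P, (F x : ℂ) * Complex.exp (m * x) := by
      refine intervalIntegral.integral_congr fun x _ => ?_
      simp only [hFC, fourier_coe_apply, smul_eq_mul, hm]
      rw [mul_comm]
      congr 2
      push_cast
      ring
    have e2 : ∫ x in (0 : ℝ)..P, (f x : ℂ) * (m⁻¹ * Complex.exp (m * x)) = m⁻¹ * a n := by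
      rw [ha, ← intervalIntegral.integral_const_mul]
      refine intervalIntegral.integral_congr fun x _ => ?_
      simp only [hm]
      rw [show -(2 * Real.pi * Complex.I * n / P) * (x : ℂ) =
        -(2 * Real.pi * Complex.I * n * x / P) by ring]
      ring
    rw [e1, hbp, e2, Complex.real_smul]
    push_cast
    rw [hm]
    field_simp
    ring
  have hsq : Summable fun n : ℤ => ‖a n‖ ^ 2 := by
    have hm : MemLp (fun x => (f x : ℂ)) 2 (volume.restrict (Set.Ioc 0 P)) := by
      rw [← Measure.restrict_congr_set (Ioo_ae_eq_Ioc (μ := volume) (a := 0) (b := P))]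
      exact (hf 0 P).ofReal
    have h := (hasSum_sq_fourierCoeffOn hP hm).summable
    have e : ∀ n : ℤ, a n = P * fourierCoeffOn hP (fun x => (f x : ℂ)) n := by
      intro n
      rw [fourierCoeffOn_eq_integral, Complex.real_smul, ← mul_assoc]
      have : (P : ℂ) * ((1 / (P - 0) : ℝ) : ℂ) = 1 := by
        push_cast
        rw [sub_zero, mul_one_div_cancel hPC]
      rw [this, one_mul, ha]
      refine intervalIntegral.integral_congr fun x _ => ?_
      simp only [fourier_coe_apply, smul_eq_mul]
      rw [mul_comm]
      congr 2
      push_cast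
      rw [sub_zero]
      ring
    simp only [e, norm_mul, mul_pow]
    exact h.mul_left _
  -- `‖a n‖ / |n| ≤ ‖a n‖² + 1/n²`, where the first term is summable by Parseval. The index `0` is
  -- irrelevant to summability and its coefficient stays unspecified.
  have hsum : Summable (fourierCoeff FC) := by
    refine Summable.of_norm_bounded_eventually (g := fun n : ℤ => ‖a n‖ ^ 2 + 1 / (n : ℝ) ^ 2)
      (hsq.add (Real.summable_one_div_int_pow.2 (by norm_num))) ?_
    filter_upwards [(Set.finite_singleton (0 : ℤ)).compl_mem_cofinite] with n hn
    have hn : n ≠ 0 := hn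
    rw [hcoef n hn, norm_mul]
    have hnorm : ‖1 / (2 * Real.pi * Complex.I * n : ℂ)‖ = 1 / (2 * Real.pi * |(n : ℝ)|) := by
      simp [abs_of_pos Real.pi_pos]
    rw [hnorm]
    have hn' : 0 < |(n : ℝ)| := abs_pos.2 (by exact_mod_cast hn)
    have h1 : 1 / (2 * Real.pi * |(n : ℝ)|) ≤ 1 / |(n : ℝ)| := by
      apply one_div_le_one_div_of_le hn'
      nlinarith [Real.pi_gt_three]
    have h2 : 1 / (n : ℝ) ^ 2 = (1 / |(n : ℝ)|) ^ 2 := by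
      rw [div_pow, sq_abs, one_pow]
    rw [h2]
    have h3 : 1 / (2 * Real.pi * |(n : ℝ)|) * ‖a n‖ ≤ 1 / |(n : ℝ)| * ‖a n‖ :=
      mul_le_mul_of_nonneg_right h1 (norm_nonneg _)
    nlinarith [sq_nonneg (1 / |(n : ℝ)| - ‖a n‖), sq_nonneg (1 / |(n : ℝ)|), sq_nonneg ‖a n‖]
  refine ⟨fourierCoeff FC, hcoef, fun y => ?_⟩
  have h := has_pointwise_sum_fourier_series_of_summable hsum (y : AddCircle P)
  rw [hFC] at h
  refine h.congr_fun fun n => ?_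
  rw [fourier_coe_apply, smul_eq_mul]

/-! ### The periodic profile and the coefficient formulas. -/

theorem gam_pos {v : ℝ} (hv0 : 0 < v) (hv1 : v < 1) : 0 < gam v :=
  div_pos (by linarith) (by linarith)

theorem L₂_eq {v : ℝ} (hv1 : v < 1) (L : ℝ) : L₂ v L = L + gam v * L := by
  have : 1 - v ≠ 0 := by linarith
  rw [L₂, gam]
  field_simp
  ring

/-- `f` is the periodic profile of the travelling waves generated by the data `(g, h)`, where `g`
is the derivative of the initial shape and `h` the initial velocity. -/
structure IsProfile (v L : ℝ) (g h f : ℝ → ℝ) : Prop where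
  periodic : Function.Periodic f (L₂ v L)
  memL2 : ∀ a b, MemL2 a b f
  right : ∀ x ∈ Set.Ioo 0 L, f x = (g x + h x) / 2
  left : ∀ x ∈ Set.Ioo 0 L, gam v * f (-gam v * x) = (g x - h x) / 2

/-- The two initial conditions solved for `f` prescribe it on `(0,L)` and on `(-γL,0)`, which
together fill one period up to null sets. The extension is by reduction modulo `L₂` to the window
`(-γL, L]`. -/
theorem exists_isProfile {v L : ℝ} (hv0 : 0 < v) (hv1 : v < 1) (hL : 0 < L) {g h : ℝ → ℝ}
    (hg : MemL2 0 L g) (hh : MemL2 0 L h) : ∃ f, IsProfile v L g h f := by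
  have hγ := gam_pos hv0 hv1
  set γ := gam v with hγd
  have hP : 0 < L₂ v L := by rw [L₂_eq hv1]; positivity
  have hγL : -(γ * L) + L₂ v L = L := by rw [L₂_eq hv1]; ring
  have hγL0 : 0 < γ * L := by positivity
  set f₀ : ℝ → ℝ := fun x => if 0 < x then (g x + h x) / 2
    else 1 / γ * ((g (-γ⁻¹ * x) - h (-γ⁻¹ * x)) / 2) with hf₀
  have hγi : -γ⁻¹ ≠ 0 := by simp [hγ.ne']
  have hf₀r : MemLp f₀ 2 (volume.restrict (Set.Ioo 0 L)) := by
    have h1 : MemL2 0 L (fun x => (1 / 2) * (g x + h x)) := (MemLp.add hg hh).const_mul (1 / 2)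
    refine h1.congr fun x hx => ?_
    simp only [hf₀, if_pos hx.1]
    ring
  have hf₀l : MemLp f₀ 2 (volume.restrict (Set.Ioo (-(γ * L)) 0)) := by
    have h1 : MemLp (fun x => (1 / γ * (1 / 2)) * (g x - h x)) 2 (volume.restrict (Set.Ioo 0 L)) :=
      (MemLp.sub hg hh).const_mul _
    have h2 := memLp_comp_affine hγi 0 h1
    have h3 : MemL2 (-(γ * L)) 0 (fun x => (1 / γ * (1 / 2)) *
        (g (-γ⁻¹ * x + 0) - h (-γ⁻¹ * x + 0))) := by
      refine MemLp.mono_measure (Measure.restrict_mono (fun x hx => ?_) le_rfl) h2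
      have e : -γ⁻¹ * x + 0 = -x / γ := by ring
      change -γ⁻¹ * x + 0 ∈ Set.Ioo 0 L
      rw [e]
      exact ⟨div_pos (by linarith [hx.2]) hγ, (div_lt_iff₀ hγ).2 (by linarith [hx.1])⟩
    refine h3.congr fun x hx => ?_
    simp only [hf₀, if_neg (not_lt.2 hx.2.le), add_zero]
    ring
  have hf₀m : MemL2 (-(γ * L)) L f₀ := by
    have hu : Set.Ioo (-(γ * L)) L = Set.Ioc (-(γ * L)) 0 ∪ Set.Ioo 0 L :=
      (Set.Ioc_union_Ioo_eq_Ioo (by linarith) hL).symm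
    have hd : Disjoint (Set.Ioc (-(γ * L)) 0) (Set.Ioo 0 L) :=
      Set.disjoint_left.2 fun x hx hx' => absurd hx.2 (not_le.2 hx'.1)
    rw [Measure.restrict_congr_set (Ioo_ae_eq_Ioc (μ := volume))] at hf₀l
    have i1 := (memLp_two_iff_integrable_sq hf₀l.1).1 hf₀l
    have i2 := (memLp_two_iff_integrable_sq hf₀r.1).1 hf₀r
    have hm : AEStronglyMeasurable f₀ (volume.restrict (Set.Ioo (-(γ * L)) L)) := by
      rw [hu]
      exact aestronglyMeasurable_union_iff.2 ⟨hf₀l.1, hf₀r.1⟩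
    refine (memLp_two_iff_integrable_sq hm).2 ?_
    rw [hu]
    exact IntegrableOn.union i1 i2
  have hself : ∀ x ∈ Set.Ioc (-(γ * L)) L, toIocMod hP (-(γ * L)) x = x := fun x hx =>
    (toIocMod_eq_self hP).2 (by rwa [hγL])
  refine ⟨fun x => f₀ (toIocMod hP (-(γ * L)) x), ?_, ?_, ?_, ?_⟩
  · exact fun x => by simp only [toIocMod_add_right]
  · refine memL2_of_periodic (a := -(γ * L)) hP (fun x => by simp only [toIocMod_add_right]) ?_
    rw [hγL]
    exact hf₀m.congr fun x hx => by rw [hself x ⟨hx.1, hx.2.le⟩]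
  · intro x hx
    simp only [hself x ⟨by linarith [hx.1], hx.2.le⟩, hf₀, if_pos hx.1]
  · intro x hx
    have hneg : -γ * x < 0 := by nlinarith [hx.1]
    have hlow : -(γ * L) < -γ * x := by nlinarith [hx.2]
    rw [hself _ ⟨hlow, by linarith⟩]
    simp only [hf₀, if_neg (not_lt.2 hneg.le)]
    have e : -γ⁻¹ * (-γ * x) = x := by field_simp
    rw [e, ← hγd]
    field_simp

section Profile

variable {v L : ℝ} {g h f : ℝ → ℝ}

/-- The period is taken to be `(-γL, L)` and cut at `0`; the substitution `x ↦ -γx` brings its left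
piece back to `(0,L)`. -/
theorem IsProfile.integral_period_eq (hv0 : 0 < v) (hv1 : v < 1) (hf : IsProfile v L g h f)
    {k : ℝ → ℂ} (hk : Continuous k) (hkp : Function.Periodic k (L₂ v L)) :
    ∫ x in (0 : ℝ)..L₂ v L, (f x : ℂ) * k x =
      (∫ x in (0 : ℝ)..L, (f x : ℂ) * k x) +
        ∫ x in (0 : ℝ)..L, ((gam v * f (-gam v * x) : ℝ) : ℂ) * k (-gam v * x) := by
  have hγ := gam_pos hv0 hv1
  have hp : Function.Periodic (fun x => (f x : ℂ) * k x) (L₂ v L) := fun x => by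
    simp only [hf.periodic x, hkp x]
  have hii : ∀ a b, IntervalIntegrable (fun x => (f x : ℂ) * k x) volume a b := by
    intro a b
    have h := intervalIntegrable_of_memL2 hf.memL2 a b
    have h' : IntervalIntegrable (fun x => (f x : ℂ)) volume a b :=
      ⟨Integrable.ofReal h.1, Integrable.ofReal h.2⟩
    exact h'.mul_continuousOn hk.continuousOn
  have h1 := hp.intervalIntegral_add_eq 0 (-(gam v * L))
  rw [zero_add, show -(gam v * L) + L₂ v L = L by rw [L₂_eq hv1]; ring,
    ← intervalIntegral.integral_add_adjacent_intervals (hii (-(gam v * L)) 0) (hii 0 L)] at h1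
  rw [h1, add_comm]
  congr 1
  have h2 := intervalIntegral.smul_integral_comp_mul_left (a := 0) (b := L)
    (fun x => (f x : ℂ) * k x) (-gam v)
  rw [mul_zero, show -gam v * L = -(gam v * L) by ring,
    intervalIntegral.integral_symm (-(gam v * L)) 0, Complex.real_smul,
    ← intervalIntegral.integral_const_mul] at h2
  rw [← neg_eq_iff_eq_neg.2 h2, ← intervalIntegral.integral_neg]
  refine intervalIntegral.integral_congr fun x _ => ?_
  push_cast
  ring

/-- The two pieces contribute `∫ (g+h)/2` and `∫ (g-h)/2`: the velocity cancels and `g` has mean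
zero. -/
theorem IsProfile.integral_eq_zero (hv0 : 0 < v) (hv1 : v < 1) (hL : 0 < L)
    (hg : MemL2 0 L g) (hh : MemL2 0 L h) (hg0 : ∫ x in (0 : ℝ)..L, g x = 0)
    (hf : IsProfile v L g h f) : ∫ x in (0 : ℝ)..L₂ v L, f x = 0 := by
  have h1 := hf.integral_period_eq hv0 hv1 (k := fun _ => 1) continuous_const (fun _ => rfl)
  simp only [mul_one] at h1
  rw [intervalIntegral.integral_ofReal, intervalIntegral.integral_ofReal,
    intervalIntegral.integral_ofReal, ← Complex.ofReal_add, Complex.ofReal_inj] at h1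
  have e1 : ∫ x in (0 : ℝ)..L, f x = ∫ x in (0 : ℝ)..L, (g x + h x) / 2 := by
    rw [intervalIntegral_eq_integral_Ioo hL.le, intervalIntegral_eq_integral_Ioo hL.le]
    exact setIntegral_congr_fun measurableSet_Ioo hf.right
  have e2 : ∫ x in (0 : ℝ)..L, gam v * f (-gam v * x) = ∫ x in (0 : ℝ)..L, (g x - h x) / 2 := by
    rw [intervalIntegral_eq_integral_Ioo hL.le, intervalIntegral_eq_integral_Ioo hL.le]
    exact setIntegral_congr_fun measurableSet_Ioo hf.left
  have ig := hg.intervalIntegrable hL.le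
  have ih := hh.intervalIntegrable hL.le
  rw [h1, e1, e2, intervalIntegral.integral_div, intervalIntegral.integral_div,
    intervalIntegral.integral_add ig ih, intervalIntegral.integral_sub ig ih, hg0]
  ring

theorem IsProfile.coeffPlus_eq_integral (hv0 : 0 < v) (hv1 : v < 1) (hL : 0 < L)
    (hf : IsProfile v L g h f) (n : ℤ) :
    coeffPlus v L g h n = 1 / (2 * n * Real.pi * Complex.I) *
      ∫ x in (0 : ℝ)..L₂ v L, (f x : ℂ) * Complex.exp (-(n * Real.pi * Complex.I * (1 - v) * x / L)) := by
  have hγ := gam_pos hv0 hv1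
  have hP : L ≤ L₂ v L := by
    rw [L₂_eq hv1]
    nlinarith
  have h1 : 1 - v ≠ 0 := by linarith
  have h2 : 1 + v ≠ 0 := by linarith
  have key : ∀ᵐ x, x ∈ Set.uIoc 0 (L₂ v L) → extX v L g x + extT v L h x = 2 * f x := by
    filter_upwards [compl_mem_ae_iff.2 (measure_singleton L),
      compl_mem_ae_iff.2 (measure_singleton (L₂ v L))] with x hxL hxP hx
    rw [Set.uIoc_of_le (hL.le.trans hP)] at hx
    have hxP' : x < L₂ v L := lt_of_le_of_ne hx.2 hxP
    rcases lt_or_gt_of_ne hxL with hlt | hgt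
    · rw [extX, extT, if_neg (not_lt.2 hx.1.le), if_neg (not_lt.2 hx.1.le), if_pos hlt, if_pos hlt,
        hf.right x ⟨hx.1, hlt⟩]
      ring
    · have hnl : ¬ x < L := not_lt.2 hgt.le
      rw [extX, extT, if_neg (not_lt.2 hx.1.le), if_neg (not_lt.2 hx.1.le), if_neg hnl, if_neg hnl]
      -- `y` is the point of `(0,L)` with `-γy = x - L₂`, so periodicity reduces `x` to the part of
      -- the window governed by `hf.left`. The points `L` and `L₂`, where `y` would be an endpoint,
      -- were discarded as null.
      set y := 1 / gam v * (-x) + 2 * L / (1 + v) with hy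
      have hyx : -gam v * y = x - L₂ v L := by
        rw [hy, L₂, gam]
        field_simp
        ring
      have hym : y ∈ Set.Ioo 0 L := by
        have hPe := L₂_eq hv1 L
        constructor
        · by_contra hc
          push Not at hc
          nlinarith
        · by_contra hc
          push Not at hc
          nlinarith
      have := hf.left y hym
      rw [hyx, hf.periodic.sub_eq] at this
      have hfx : f x = 1 / gam v * ((g y - h y) / 2) := by
        rw [← this]
        field_simp
      rw [hfx]
      field_simp
      ring
  have hi : ∫ x in (0 : ℝ)..L₂ v L, ((extX v L g x + extT v L h x : ℝ) : ℂ) *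
        Complex.exp (-(n * Real.pi * Complex.I * (1 - v) * x / L)) =
      2 * ∫ x in (0 : ℝ)..L₂ v L, (f x : ℂ) *
        Complex.exp (-(n * Real.pi * Complex.I * (1 - v) * x / L)) := by
    rw [← intervalIntegral.integral_const_mul]
    refine intervalIntegral.integral_congr_ae ?_
    filter_upwards [key] with x hx hxm
    rw [hx hxm]
    push_cast
    ring
  rw [coeffPlus, hi, ← mul_assoc]
  congr 1
  rcases eq_or_ne n 0 with rfl | hn
  · simp
  · have hnC : (n : ℂ) ≠ 0 := by exact_mod_cast hn
    have hpi : (Real.pi : ℂ) ≠ 0 := by exact_mod_cast Real.pi_ne_zero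
    have hI := Complex.I_ne_zero
    field_simp
    norm_num

theorem periodic_exp_mode (hv1 : v < 1) (hL : 0 < L) (n : ℤ) :
    Function.Periodic (fun x : ℝ => Complex.exp (-(n * Real.pi * Complex.I * (1 - v) * x / L)))
      (L₂ v L) := by
  intro x
  have h1 : (1 - v : ℂ) ≠ 0 := by
    have : 1 - v ≠ 0 := by linarith
    exact_mod_cast this
  have hLC : (L : ℂ) ≠ 0 := by exact_mod_cast hL.ne'
  simp only [L₂]
  rw [show -(n * Real.pi * Complex.I * (1 - v) * ((x + 2 / (1 - v) * L : ℝ) : ℂ) / L) =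
      -(n * Real.pi * Complex.I * (1 - v) * x / L) + ((-n : ℤ) : ℂ) * (2 * Real.pi * Complex.I) by
    push_cast
    field_simp
    ring]
  rw [Complex.exp_add, Complex.exp_int_mul_two_pi_mul_I, mul_one]

/-- The map `x ↦ -γx` sends `(-L₁,L)` onto the period `(-γL,L)`, and `γ(1-v) = 1+v` turns one
exponential into the other. -/
theorem IsProfile.coeffMinus_eq_integral (hv0 : 0 < v) (hv1 : v < 1) (hL : 0 < L)
    (hf : IsProfile v L g h f) (n : ℤ) :
    coeffMinus v L g h n = 1 / (2 * n * Real.pi * Complex.I) *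
      ∫ x in (0 : ℝ)..L₂ v L, (f x : ℂ) * Complex.exp (-(n * Real.pi * Complex.I * (1 - v) * x / L)) := by
  have hγ := gam_pos hv0 hv1
  have h1 : 1 - v ≠ 0 := by linarith
  have h2 : 1 + v ≠ 0 := by linarith
  have h1C : (1 - v : ℂ) ≠ 0 := by exact_mod_cast h1
  have h2C : (1 + v : ℂ) ≠ 0 := by exact_mod_cast h2
  have hLC : (L : ℂ) ≠ 0 := by exact_mod_cast hL.ne'
  have hL1 : gam v * L₁ v L = L := by
    rw [L₁, gam]
    field_simp
  have hL1p : 0 < L₁ v L := by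
    by_contra hc
    push Not at hc
    nlinarith
  set k : ℝ → ℂ := fun x => Complex.exp (-(n * Real.pi * Complex.I * (1 - v) * x / L)) with hk
  have hp : Function.Periodic (fun x => (f x : ℂ) * k x) (L₂ v L) := fun x => by
    have := periodic_exp_mode hv1 hL n x
    simp only [hf.periodic x, hk]
    exact congrArg _ this
  have key : ∀ᵐ x, x ∈ Set.uIoc (-(L₁ v L)) L →
      extX v L g x - extT v L h x = 2 * (gam v * f (-gam v * x)) := by
    filter_upwards [compl_mem_ae_iff.2 (measure_singleton L),
      compl_mem_ae_iff.2 (measure_singleton 0)] with x hxL hx0 hx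
    rw [Set.uIoc_of_le (by linarith)] at hx
    have hxL' : x < L := lt_of_le_of_ne hx.2 hxL
    rcases lt_or_gt_of_ne hx0 with hlt | hgt
    · rw [extX, extT, if_pos hlt, if_pos hlt, show -gam v * x = gam v * (-x) by ring,
        hf.right (gam v * (-x)) ⟨by nlinarith, by nlinarith [hx.1]⟩]
      ring
    · rw [extX, extT, if_neg (not_lt.2 hgt.le), if_neg (not_lt.2 hgt.le), if_pos hxL', if_pos hxL',
        hf.left x ⟨hgt, hxL'⟩]
      ring
  have hi : ∫ x in (-(L₁ v L))..L, ((extX v L g x - extT v L h x : ℝ) : ℂ) *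
        Complex.exp (n * Real.pi * Complex.I * (1 + v) * x / L) =
      2 * ∫ x in (0 : ℝ)..L₂ v L, (f x : ℂ) * k x := by
    have h3 := intervalIntegral.smul_integral_comp_mul_left (a := -(L₁ v L)) (b := L)
      (fun x => (f x : ℂ) * k x) (-gam v)
    rw [show -gam v * -(L₁ v L) = L by rw [neg_mul_neg, hL1],
      intervalIntegral.integral_symm (-gam v * L) L] at h3
    have h4 := hp.intervalIntegral_add_eq 0 (-gam v * L)
    rw [zero_add, show -gam v * L + L₂ v L = L by rw [L₂_eq hv1]; ring] at h4
    rw [h4, ← neg_eq_iff_eq_neg.2 h3, Complex.real_smul, ← intervalIntegral.integral_const_mul,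
      ← intervalIntegral.integral_neg, ← intervalIntegral.integral_const_mul]
    refine intervalIntegral.integral_congr_ae ?_
    filter_upwards [key] with x hx hxm
    rw [hx hxm]
    simp only [hk]
    have : -(n * Real.pi * Complex.I * (1 - v) * ((-gam v * x : ℝ) : ℂ) / L) =
        n * Real.pi * Complex.I * (1 + v) * x / L := by
      rw [gam]
      push_cast
      field_simp
    rw [this]
    push_cast
    ring
  rw [coeffMinus, hi, ← mul_assoc]
  congr 1
  rcases eq_or_ne n 0 with rfl | hn
  · simp
  · have hnC : (n : ℂ) ≠ 0 := by exact_mod_cast hn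
    have hpi : (Real.pi : ℂ) ≠ 0 := by exact_mod_cast Real.pi_ne_zero
    have hI := Complex.I_ne_zero
    field_simp
    norm_num

/-- The Fourier expansion of the difference of travelling waves. -/
theorem IsProfile.hasSum (hv0 : 0 < v) (hv1 : v < 1) (hL : 0 < L)
    (hg : MemL2 0 L g) (hh : MemL2 0 L h) (hg0 : ∫ x in (0 : ℝ)..L, g x = 0)
    (hf : IsProfile v L g h f) (x t : ℝ) :
    HasSum (fun n : {n : ℤ // n ≠ 0} => coeffPlus v L g h n * mode v L n x t)
      (((∫ y in (0 : ℝ)..(t + x), f y) - ∫ y in (0 : ℝ)..(gam v * (t - x)), f y : ℝ) : ℂ) := by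
  have hγ := gam_pos hv0 hv1
  have hP : 0 < L₂ v L := by rw [L₂_eq hv1]; positivity
  have h1 : (1 - v : ℂ) ≠ 0 := by
    have : 1 - v ≠ 0 := by linarith
    exact_mod_cast this
  have hLC : (L : ℂ) ≠ 0 := by exact_mod_cast hL.ne'
  obtain ⟨C, hC, hsum⟩ := exists_hasSum_fourier_primitive hP hf.periodic hf.memL2
    (hf.integral_eq_zero hv0 hv1 hL hg hh hg0)
  have hsub := (hsum (t + x)).sub (hsum (gam v * (t - x)))
  rw [← Complex.ofReal_sub] at hsub
  have hexp : ∀ (n : ℤ) (y : ℝ), 2 * Real.pi * Complex.I * n * y / (L₂ v L : ℂ) =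
      n * Real.pi * Complex.I * (1 - v) * y / L := by
    intro n y
    rw [L₂]
    push_cast
    field_simp
  -- The constant Fourier term occurs in both series and cancels in the difference, so the sum may
  -- be restricted to `n ≠ 0`.
  have hs : Function.support (fun n : ℤ =>
      C n * Complex.exp (2 * Real.pi * Complex.I * n * ((t + x : ℝ) : ℂ) / (L₂ v L : ℂ)) -
      C n * Complex.exp (2 * Real.pi * Complex.I * n * ((gam v * (t - x) : ℝ) : ℂ) / (L₂ v L : ℂ)))
      ⊆ {n : ℤ | n ≠ 0} := by
    intro n hn h0
    apply hn
    simp [h0]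
  refine ((hasSum_subtype_iff_of_support_subset hs).2 hsub).congr_fun fun n => ?_
  obtain ⟨n, hn⟩ := n
  simp only [Function.comp_apply]
  have hc : C n = coeffPlus v L g h n := by
    rw [hC n hn, hf.coeffPlus_eq_integral hv0 hv1 hL]
    congr 1
    · congr 1
      ring
    · refine intervalIntegral.integral_congr fun y _ => ?_
      simp only [hexp]
  rw [hc, hexp, hexp, mode, mul_sub]
  congr 3
  · push_cast
    ring
  · rw [gam]
    push_cast
    congr 1
    field_simp

/-- The coefficients as pairings of the data with the spatial modes on `(0,L)`. -/
theorem IsProfile.coeffPlus_eq (hv0 : 0 < v) (hv1 : v < 1) (hL : 0 < L)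
    (hg : MemL2 0 L g) (hh : MemL2 0 L h) (hf : IsProfile v L g h f) (n : ℤ) {μ : ℂ}
    (hμ : μ = -(n * Real.pi * Complex.I) / L) :
    coeffPlus v L g h n = 1 / (4 * n * Real.pi * Complex.I) *
      ((∫ x in (0 : ℝ)..L, (h x : ℂ) *
          (Complex.exp (μ * (1 - v) * x) - Complex.exp (-(μ * (1 + v)) * x))) +
        ∫ x in (0 : ℝ)..L, (g x : ℂ) *
          (Complex.exp (μ * (1 - v) * x) + Complex.exp (-(μ * (1 + v)) * x))) := by
  have h1 : (1 - v : ℂ) ≠ 0 := by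
    have : 1 - v ≠ 0 := by linarith
    exact_mod_cast this
  have hLC : (L : ℂ) ≠ 0 := by exact_mod_cast hL.ne'
  rw [hf.coeffPlus_eq_integral hv0 hv1 hL, hf.integral_period_eq hv0 hv1 (by fun_prop)
    (periodic_exp_mode hv1 hL n)]
  have e1 : ∫ x in (0 : ℝ)..L, (f x : ℂ) *
      Complex.exp (-(n * Real.pi * Complex.I * (1 - v) * x / L)) =
      ∫ x in (0 : ℝ)..L, (((g x + h x) / 2 : ℝ) : ℂ) * Complex.exp (μ * (1 - v) * x) := by
    rw [intervalIntegral_eq_integral_Ioo hL.le, intervalIntegral_eq_integral_Ioo hL.le]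
    refine setIntegral_congr_fun measurableSet_Ioo fun x hx => ?_
    simp only [hf.right x hx, hμ]
    congr 2
    ring
  have e2 : ∫ x in (0 : ℝ)..L, ((gam v * f (-gam v * x) : ℝ) : ℂ) *
      Complex.exp (-(n * Real.pi * Complex.I * (1 - v) * ((-gam v * x : ℝ) : ℂ) / L)) =
      ∫ x in (0 : ℝ)..L, (((g x - h x) / 2 : ℝ) : ℂ) * Complex.exp (-(μ * (1 + v)) * x) := by
    rw [intervalIntegral_eq_integral_Ioo hL.le, intervalIntegral_eq_integral_Ioo hL.le]
    refine setIntegral_congr_fun measurableSet_Ioo fun x hx => ?_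
    simp only [hf.left x hx, hμ]
    congr 2
    rw [gam]
    push_cast
    field_simp
  rw [e1, e2]
  have ig : IntervalIntegrable (fun x => (g x : ℂ)) volume 0 L :=
    ⟨Integrable.ofReal (hg.intervalIntegrable hL.le).1, Integrable.ofReal (hg.intervalIntegrable hL.le).2⟩
  have ih : IntervalIntegrable (fun x => (h x : ℂ)) volume 0 L :=
    ⟨Integrable.ofReal (hh.intervalIntegrable hL.le).1, Integrable.ofReal (hh.intervalIntegrable hL.le).2⟩
  have j : ∀ {q : ℝ → ℂ} (_ : IntervalIntegrable q volume 0 L) {k : ℝ → ℂ} (_ : Continuous k),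
      IntervalIntegrable (fun x => q x * k x) volume 0 L :=
    fun hq _ hk => hq.mul_continuousOn hk.continuousOn
  have c1 : Continuous fun x : ℝ => Complex.exp (μ * (1 - v) * x) := by fun_prop
  have c2 : Continuous fun x : ℝ => Complex.exp (-(μ * (1 + v)) * x) := by fun_prop
  have s1 : ∫ x in (0 : ℝ)..L, (h x : ℂ) *
      (Complex.exp (μ * (1 - v) * x) - Complex.exp (-(μ * (1 + v)) * x)) =
      (∫ x in (0 : ℝ)..L, (h x : ℂ) * Complex.exp (μ * (1 - v) * x)) -
        ∫ x in (0 : ℝ)..L, (h x : ℂ) * Complex.exp (-(μ * (1 + v)) * x) := by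
    rw [← intervalIntegral.integral_sub (j ih c1) (j ih c2)]
    exact intervalIntegral.integral_congr fun x _ => mul_sub _ _ _
  have s2 : ∫ x in (0 : ℝ)..L, (g x : ℂ) *
      (Complex.exp (μ * (1 - v) * x) + Complex.exp (-(μ * (1 + v)) * x)) =
      (∫ x in (0 : ℝ)..L, (g x : ℂ) * Complex.exp (μ * (1 - v) * x)) +
        ∫ x in (0 : ℝ)..L, (g x : ℂ) * Complex.exp (-(μ * (1 + v)) * x) := by
    rw [← intervalIntegral.integral_add (j ig c1) (j ig c2)]
    exact intervalIntegral.integral_congr fun x _ => mul_add _ _ _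
  rw [s1, s2]
  have f1 : ∫ x in (0 : ℝ)..L, (((g x + h x) / 2 : ℝ) : ℂ) * Complex.exp (μ * (1 - v) * x) =
      (1 / 2) * ((∫ x in (0 : ℝ)..L, (g x : ℂ) * Complex.exp (μ * (1 - v) * x)) +
        ∫ x in (0 : ℝ)..L, (h x : ℂ) * Complex.exp (μ * (1 - v) * x)) := by
    rw [← intervalIntegral.integral_add (j ig c1) (j ih c1), ← intervalIntegral.integral_const_mul]
    refine intervalIntegral.integral_congr fun x _ => ?_
    push_cast
    ring
  have f2 : ∫ x in (0 : ℝ)..L, (((g x - h x) / 2 : ℝ) : ℂ) * Complex.exp (-(μ * (1 + v)) * x) =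
      (1 / 2) * ((∫ x in (0 : ℝ)..L, (g x : ℂ) * Complex.exp (-(μ * (1 + v)) * x)) -
        ∫ x in (0 : ℝ)..L, (h x : ℂ) * Complex.exp (-(μ * (1 + v)) * x)) := by
    rw [← intervalIntegral.integral_sub (j ig c2) (j ih c2), ← intervalIntegral.integral_const_mul]
    refine intervalIntegral.integral_congr fun x _ => ?_
    push_cast
    ring
  rw [f1, f2]
  rcases eq_or_ne n 0 with rfl | hn
  · simp
  · have hnC : (n : ℂ) ≠ 0 := by exact_mod_cast hn
    have hpi : (Real.pi : ℂ) ≠ 0 := by exact_mod_cast Real.pi_ne_zero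
    have hI := Complex.I_ne_zero
    field_simp
    ring

/-- The travelling waves reproduce the initial shape. -/
theorem IsProfile.integral_sub_integral_eq (hv0 : 0 < v) (hv1 : v < 1)
    (hf : IsProfile v L g h f) {x : ℝ} (hx : x ∈ Set.Icc 0 L) :
    (∫ y in (0 : ℝ)..x, f y) - ∫ y in (0 : ℝ)..(gam v * -x), f y = ∫ y in (0 : ℝ)..x, g y := by
  have hii := intervalIntegrable_of_memL2 hf.memL2
  have h2 := intervalIntegral.smul_integral_comp_mul_left (a := 0) (b := x) f (-gam v)
  rw [mul_zero, smul_eq_mul, ← intervalIntegral.integral_const_mul] at h2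
  rw [show gam v * -x = -gam v * x by ring, ← h2, ← intervalIntegral.integral_sub (hii 0 x)]
  · rw [intervalIntegral_eq_integral_Ioo hx.1, intervalIntegral_eq_integral_Ioo hx.1]
    refine setIntegral_congr_fun measurableSet_Ioo fun y hy => ?_
    have hyL : y ∈ Set.Ioo 0 L := ⟨hy.1, hy.2.trans_le hx.2⟩
    have := hf.left y hyL
    have := hf.right y hyL
    linarith
  · have := MemL2.comp_affine (c := -gam v) (neg_ne_zero.2 (gam_pos hv0 hv1).ne') 0 hf.memL2
    simp only [add_zero] at this
    exact (intervalIntegrable_of_memL2 this 0 x).const_mul _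

end Profile

/-! ### Every weak solution is the sum of the series. -/

/-- Expansion of a pair of data in the modes at time `0`. -/
theorem HasH10Deriv.hasSum_mode {v L : ℝ} (hv0 : 0 < v) (hv1 : v < 1) (hL : 0 < L)
    {u g h : ℝ → ℝ} (hu : HasH10Deriv 0 L u g) (hh : MemL2 0 L h) :
    ∀ᵐ η ∂(volume.restrict (Set.Ioo 0 L)),
      HasSum (fun n : {n : ℤ // n ≠ 0} => coeffPlus v L g h n * mode v L n η 0) ((u η : ℝ) : ℂ) := by
  obtain ⟨f, hf⟩ := exists_isProfile hv0 hv1 hL hu.2.1 hh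
  filter_upwards [hu.ae_eq_integral, ae_restrict_mem measurableSet_Ioo] with η hη hm
  have h1 := hf.hasSum hv0 hv1 hL hu.2.1 hh (hu.integral_eq_zero hL.le) η 0
  rwa [zero_add, zero_sub, hf.integral_sub_integral_eq hv0 hv1 (Set.Ioo_subset_Icc_self hm),
    ← hη] at h1

/-- The coefficients of the data of a solution at time `t`. -/
theorem coeffPlus_of_isSolution {v L T : ℝ} (hv0 : 0 < v) (hv1 : v < 1) (hL : 0 < L) (hT : 0 < T)
    {φ0 φ0x φ1 : ℝ → ℝ} (h0 : HasH10Deriv 0 L φ0 φ0x) (h1 : MemL2 0 L φ1) {φ φx φt : ℝ → ℝ → ℝ}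
    (hH : ∀ t ∈ Set.Icc 0 T,
      HasH10Deriv (v * t) (L + v * t) (fun x => φ x t) (fun x => φx x t))
    (hc : ContL2 v L T φ) (hcx : ContL2 v L T φx) (hct : ContL2 v L T φt)
    (hW : ∀ ψ, IsTestFun (domainQ v L T) ψ →
      integralQ v L T (fun x t => φ x t * dT ψ x t)
        = - integralQ v L T (fun x t => φt x t * ψ (x, t)))
    (hW' : ∀ ψ, IsTestFun (domainQ v L T) ψ →
      integralQ v L T (fun x t => φt x t * dT ψ x t - φx x t * dX ψ x t) = 0)
    (hi : ∀ᵐ x ∂(volume.restrict (Set.Ioo 0 L)), φ x 0 = φ0 x)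
    (hi' : ∀ᵐ x ∂(volume.restrict (Set.Ioo 0 L)), φt x 0 = φ1 x)
    (n : ℤ) {t : ℝ} (ht : t ∈ Set.Icc 0 T) :
    coeffPlus v L (fun η => φx (η + v * t) t) (fun η => φt (η + v * t) t) n =
      Complex.exp (n * Real.pi * Complex.I * (1 - v ^ 2) * t / L) * coeffPlus v L φ0x φ1 n := by
  obtain ⟨u, hu, hu'⟩ := hc.exists_curve hT.le
  obtain ⟨x, hx, hx'⟩ := hcx.exists_curve hT.le
  obtain ⟨w, hw, hw'⟩ := hct.exists_curve hT.le
  have hE : EnergyCurves v L T φ φx φt u x w := ⟨hu, hx, hw, hu', hx', hw'⟩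
  have hLC : (L : ℂ) ≠ 0 := by exact_mod_cast hL.ne'
  have ht0 : (0 : ℝ) ∈ Set.Icc 0 T := Set.left_mem_Icc.2 hT.le
  set μ : ℂ := -(n * Real.pi * Complex.I) / L with hμ
  -- With this `μ` the two exponents at `η = L` differ by `-2πin`, so `θ` vanishes at `L` as well as
  -- at `0`.
  have hμL : Complex.exp (μ * (1 - v) * L) = Complex.exp (-(μ * (1 + v)) * L) := by
    have : μ * (1 - v) * L = -(μ * (1 + v)) * L + ((-n : ℤ) : ℂ) * (2 * Real.pi * Complex.I) := by
      rw [hμ]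
      push_cast
      field_simp
      ring
    rw [this, Complex.exp_add, Complex.exp_int_mul_two_pi_mul_I, mul_one]
  set θ : ℝ → ℂ := fun η => Complex.exp (μ * (1 - v) * η) - Complex.exp (-(μ * (1 + v)) * η) with hθ
  set κ : ℝ → ℂ := fun η => Complex.exp (μ * (1 - v) * η) + Complex.exp (-(μ * (1 + v)) * η) with hκ
  have hθc : Continuous θ := by fun_prop
  have hκc : Continuous κ := by fun_prop
  have hcons := hE.conservation hL hT hH hW hW' hμL hθc hκc (fun _ => rfl) (fun _ => rfl) ht
  have c0 : coeffPlus v L φ0x φ1 n = 1 / (4 * n * Real.pi * Complex.I) *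
      (pairing θ hθc (w 0) + pairing κ hκc (x 0)) := by
    obtain ⟨f, hf⟩ := exists_isProfile hv0 hv1 hL h0.2.1 h1
    rw [hf.coeffPlus_eq hv0 hv1 hL h0.2.1 h1 n hμ]
    congr 2
    · refine (pairing_eq hL.le hθc ?_).symm
      filter_upwards [hw' 0 ht0, hi'] with η e1 e2
      rw [e1, mul_zero, add_zero, e2]
    · have hκd : ∀ η : ℝ, HasDerivAt κ (μ * (1 - v) * Complex.exp (μ * (1 - v) * η) +
          -(μ * (1 + v)) * Complex.exp (-(μ * (1 + v)) * η)) η :=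
        fun η => (hasDerivAt_cexp_mul _ η).add (hasDerivAt_cexp_mul _ η)
      -- That `φx(·,0)` equals `φ0x` is not part of being a solution; both pairings are integrated
      -- by parts onto `φ(·,0) = φ0`.
      rw [h0.integral_mul_eq_complex hL.le hκd (by fun_prop),
        hE.pairing_x_eq hL.le hH hκd hκc (by fun_prop) ht0]
      congr 1
      refine (pairing_eq hL.le _ ?_).symm
      filter_upwards [hu' 0 ht0, hi] with η e1 e2
      rw [e1, mul_zero, add_zero, e2]
  have ct : coeffPlus v L (fun η => φx (η + v * t) t) (fun η => φt (η + v * t) t) n =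
      1 / (4 * n * Real.pi * Complex.I) * (pairing θ hθc (w t) + pairing κ hκc (x t)) := by
    obtain ⟨f, hf⟩ := exists_isProfile hv0 hv1 hL (hcx.memL2 ht) (hct.memL2 ht)
    rw [hf.coeffPlus_eq hv0 hv1 hL (hcx.memL2 ht) (hct.memL2 ht) n hμ,
      pairing_eq hL.le hθc (hw' t ht), pairing_eq hL.le hκc (hx' t ht)]
  rw [c0, ct, ← hcons, mul_left_comm, ← mul_assoc (Complex.exp _) (Complex.exp _),
    ← Complex.exp_add]
  have : n * Real.pi * Complex.I * (1 - v ^ 2) * t / L + μ * (1 - v ^ 2) * t = 0 := by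
    rw [hμ]
    field_simp
    ring
  rw [this, Complex.exp_zero, one_mul]

/-- Every solution is almost everywhere the sum of the series. -/
theorem IsSolution.ae_hasSum {v L T : ℝ} (hv0 : 0 < v) (hv1 : v < 1) (hL : 0 < L) (hT : 0 < T)
    {φ0 φ0x φ1 : ℝ → ℝ} (h0 : HasH10Deriv 0 L φ0 φ0x) (h1 : MemL2 0 L φ1) {φ : ℝ → ℝ → ℝ}
    (hφ : IsSolution v L T φ0 φ1 φ) {t : ℝ} (ht : t ∈ Set.Icc 0 T) :
    ∀ᵐ x ∂(volume.restrict (Set.Ioo (v * t) (L + v * t))),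
      HasSum (fun n : {n : ℤ // n ≠ 0} => coeffPlus v L φ0x φ1 n * mode v L n x t)
        ((φ x t : ℝ) : ℂ) := by
  obtain ⟨φx, φt, hH, hc, hcx, hct, hW, hW', hi, hi'⟩ := hφ
  have hs : HasH10Deriv 0 L (fun η => φ (η + v * t) t) (fun η => φx (η + v * t) t) := by
    refine HasH10Deriv.comp_add_right (v * t) (u := fun x => φ x t) (g := fun x => φx x t) ?_
    rw [zero_add]
    exact hH t ht
  -- The state at time `t`, read in the moving frame, serves as initial data on `(0,L)`.
  have key := hs.hasSum_mode hv0 hv1 hL (hct.memL2 ht)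
  have hmp := (measurePreserving_add_right volume (-(v * t))).restrict_preimage
    (measurableSet_Ioo (a := (0 : ℝ)) (b := L))
  rw [Set.preimage_add_const_Ioo, sub_neg_eq_add, sub_neg_eq_add, zero_add] at hmp
  filter_upwards [hmp.quasiMeasurePreserving.ae key] with x hx
  rw [neg_add_cancel_right] at hx
  refine hx.congr_fun fun n => ?_
  rw [coeffPlus_of_isSolution hv0 hv1 hL hT h0 h1 hH hc hcx hct hW hW' hi hi' n ht,
    mul_comm (Complex.exp _), mul_assoc]
  congr 1
  -- With `η = x - vt`, the mode at `(x,t)` is `e^{nπi(1-v²)t/L}` times the mode at `(η,0)`, the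
  -- very phase carried by the coefficient.
  rw [mode, mode, mul_sub (Complex.exp _), ← Complex.exp_add, ← Complex.exp_add]
  congr 2 <;>
  · push_cast
    ring

/-- A continuous representative of a solution is everywhere the sum of the series. -/
theorem IsSolution.hasSum_of_continuousOn {v L T : ℝ} (hv0 : 0 < v) (hv1 : v < 1) (hL : 0 < L)
    (hT : 0 < T) {φ0 φ0x φ1 : ℝ → ℝ} (h0 : HasH10Deriv 0 L φ0 φ0x) (h1 : MemL2 0 L φ1)
    {φ : ℝ → ℝ → ℝ} (hφ : IsSolution v L T φ0 φ1 φ) {t : ℝ} (ht : t ∈ Set.Icc 0 T)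
    (hc : ContinuousOn (fun x => φ x t) (Set.Ioo (v * t) (L + v * t))) :
    ∀ x ∈ Set.Ioo (v * t) (L + v * t),
      HasSum (fun n : {n : ℤ // n ≠ 0} => coeffPlus v L φ0x φ1 n * mode v L n x t)
        ((φ x t : ℝ) : ℂ) := by
  obtain ⟨f, hf⟩ := exists_isProfile hv0 hv1 hL h0.2.1 h1
  have hsum := fun x => hf.hasSum hv0 hv1 hL h0.2.1 h1 (h0.integral_eq_zero hL.le) x t
  have hF : Continuous fun y => ∫ x in (0 : ℝ)..y, f x :=
    intervalIntegral.continuous_primitive (intervalIntegrable_of_memL2 hf.memL2) 0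
  have hS : Continuous fun x => (∫ y in (0 : ℝ)..(t + x), f y) -
      ∫ y in (0 : ℝ)..(gam v * (t - x)), f y :=
    (hF.comp (continuous_const.add continuous_id)).sub
      (hF.comp (continuous_const.mul (continuous_const.sub continuous_id)))
  -- The sum of the series is continuous in `x`; two continuous functions equal almost everywhere on
  -- an open interval agree on it.
  have he := Measure.eqOn_open_of_ae_eq (μ := volume) (f := fun x => φ x t)
    (g := fun x => (∫ y in (0 : ℝ)..(t + x), f y) - ∫ y in (0 : ℝ)..(gam v * (t - x)), f y) (by
      filter_upwards [hφ.ae_hasSum hv0 hv1 hL hT h0 h1 ht] with x hx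
      exact_mod_cast hx.unique (hsum x)) isOpen_Ioo hc hS.continuousOn
  intro x hx
  have := he hx
  simp only at this
  rw [this]
  exact hsum x

/-! ### Travelling waves integrated against test functions. -/

section TravellingWave

theorem exists_abs_le_of_hasCompactSupport {k : ℝ × ℝ → ℝ} (hk : HasCompactSupport k) :
    ∃ R : ℝ, 0 < R ∧ ∀ x t, k (x, t) ≠ 0 → |x| ≤ R ∧ |t| ≤ R := by
  obtain ⟨R, hR⟩ := hk.isCompact.isBounded.subset_closedBall (0 : ℝ × ℝ)
  refine ⟨max R 1, by positivity, fun x t hxt => ?_⟩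
  have h := hR (subset_tsupport k hxt)
  rw [mem_closedBall_zero_iff, Prod.norm_def] at h
  exact ⟨(le_max_left _ _).trans (h.trans (le_max_left _ _)),
    (le_max_right _ _).trans (h.trans (le_max_left _ _))⟩

theorem integrable_mul_of_hasCompactSupport {h q : ℝ → ℝ}
    (hh : ∀ a b, IntervalIntegrable h volume a b) (hq : Continuous q) (hqs : HasCompactSupport q) :
    Integrable (fun x => h x * q x) := by
  have hl : LocallyIntegrable h volume := by
    intro x
    refine ⟨Set.Ioc (x - 1) (x + 1), Ioc_mem_nhds (by linarith) (by linarith), ?_⟩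
    exact (intervalIntegrable_iff_integrableOn_Ioc_of_le (by linarith)).1 (hh _ _)
  have := hl.integrable_smul_right_of_hasCompactSupport hq hqs
  simpa using this

variable {σ : ℝ}

/-- Change to the characteristic coordinate `y = t + σx`; the sign `σ = ±1` treats left- and
right-moving waves together. -/
theorem integral_eq_integral_wave (hσ : σ = 1 ∨ σ = -1) (t : ℝ) (G : ℝ → ℝ) :
    ∫ x, G x = ∫ y, G (σ * (y - t)) := by
  rcases hσ with rfl | rfl
  · simp only [one_mul]
    exact (integral_sub_right_eq_self G t).symm
  · simp only [neg_one_mul, neg_sub]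
    exact (integral_sub_left_eq_self G volume t).symm

theorem sq_eq_one_of_sign (hσ : σ = 1 ∨ σ = -1) : σ * σ = 1 := by
  rcases hσ with rfl | rfl <;> norm_num

theorem intervalIntegrable_wave (hσ : σ = 1 ∨ σ = -1) {h : ℝ → ℝ}
    (hh : ∀ a b, IntervalIntegrable h volume a b) (t a b : ℝ) :
    IntervalIntegrable (fun x => h (t + σ * x)) volume a b := by
  rcases hσ with rfl | rfl
  · simp only [one_mul]
    have := (hh (t + a) (t + b)).comp_add_left t
    simpa using this
  · have := (hh (t - a) (t - b)).comp_sub_left t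
    simpa [sub_eq_add_neg] using this

theorem integrable_wave_mul (hσ : σ = 1 ∨ σ = -1) {h : ℝ → ℝ}
    (hh : ∀ a b, IntervalIntegrable h volume a b) {k : ℝ × ℝ → ℝ} (hk : Continuous k)
    (hks : HasCompactSupport k) (t : ℝ) : Integrable (fun x => h (t + σ * x) * k (x, t)) := by
  refine integrable_mul_of_hasCompactSupport (intervalIntegrable_wave hσ hh t) (by fun_prop) ?_
  obtain ⟨R, hR, hz⟩ := exists_abs_le_of_hasCompactSupport hks
  refine HasCompactSupport.intro (isCompact_Icc (a := -R) (b := R)) fun x hx => ?_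
  by_contra hne
  exact hx (abs_le.1 (hz x t hne).1)

/-- Justifies Fubini in characteristic coordinates: the support of `k` forces `|t| ≤ R` and `|y| ≤
2R`, and there the integrand is an integrable product times a bounded factor. -/
theorem integrable_wave_prod {h : ℝ → ℝ} (hσ : σ = 1 ∨ σ = -1)
    (hh : ∀ a b, IntervalIntegrable h volume a b) {k : ℝ × ℝ → ℝ} (hk : Continuous k)
    (hks : HasCompactSupport k) :
    Integrable (fun p : ℝ × ℝ => h p.1 * k (σ * (p.1 - p.2), p.2))
      ((volume : Measure ℝ).prod volume) := by
  obtain ⟨R, hR, hz⟩ := exists_abs_le_of_hasCompactSupport hks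
  obtain ⟨C, hC⟩ := hks.exists_bound_of_continuous hk
  have i1 : Integrable ((Set.Icc (-(2 * R)) (2 * R)).indicator h) := by
    refine (integrable_indicator_iff measurableSet_Icc).2
      ((integrableOn_Icc_iff_integrableOn_Ioc).2 ?_)
    exact (intervalIntegrable_iff_integrableOn_Ioc_of_le (by linarith)).1 (hh _ _)
  have i2 : Integrable ((Set.Icc (-R) R).indicator (fun _ : ℝ => (1 : ℝ))) := by
    refine (integrable_indicator_iff measurableSet_Icc).2 ?_
    exact integrableOn_const (by simp) (by simp)
  have i3 := (i1.mul_prod i2).mul_bdd (c := C) (g := fun p : ℝ × ℝ => k (σ * (p.1 - p.2), p.2))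
    (Continuous.aestronglyMeasurable (by fun_prop)) (ae_of_all _ fun p => hC _)
  refine i3.congr (ae_of_all _ fun p => ?_)
  by_cases hk0 : k (σ * (p.1 - p.2), p.2) = 0
  · simp [hk0]
  · obtain ⟨h1, h2⟩ := hz _ _ hk0
    have hσa : |σ| = 1 := by rcases hσ with rfl | rfl <;> simp
    rw [abs_mul, hσa, one_mul] at h1
    have h3 : p.1 ∈ Set.Icc (-(2 * R)) (2 * R) := by
      rw [abs_le] at h1 h2
      exact ⟨by linarith [h1.1, h2.1], by linarith [h1.2, h2.2]⟩
    have h4 : p.2 ∈ Set.Icc (-R) R := abs_le.1 h2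
    beta_reduce
    rw [Set.indicator_of_mem h3, Set.indicator_of_mem h4, mul_one]

theorem integral_wave_eq (hσ : σ = 1 ∨ σ = -1) (h : ℝ → ℝ) (k : ℝ × ℝ → ℝ) (t : ℝ) :
    ∫ x, h (t + σ * x) * k (x, t) = ∫ y, h y * k (σ * (y - t), t) := by
  rw [integral_eq_integral_wave hσ t]
  refine integral_congr_ae (ae_of_all _ fun y => ?_)
  simp only [← mul_assoc, sq_eq_one_of_sign hσ, one_mul, add_sub_cancel]

theorem integrable_integral_wave (hσ : σ = 1 ∨ σ = -1) {h : ℝ → ℝ}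
    (hh : ∀ a b, IntervalIntegrable h volume a b) {k : ℝ × ℝ → ℝ} (hk : Continuous k)
    (hks : HasCompactSupport k) : Integrable (fun t => ∫ x, h (t + σ * x) * k (x, t)) := by
  simp only [integral_wave_eq hσ]
  exact (integrable_wave_prod hσ hh hk hks).integral_prod_right

/-- A travelling wave `h(t + σx)` is annihilated by the transport operator `∂_t - σ∂_x`. -/
theorem integral_wave_transport (hσ : σ = 1 ∨ σ = -1) {h : ℝ → ℝ}
    (hh : ∀ a b, IntervalIntegrable h volume a b) {ψ : ℝ × ℝ → ℝ} (hψ : ContDiff ℝ ∞ ψ)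
    (hψs : HasCompactSupport ψ) :
    ∫ t, ∫ x, h (t + σ * x) * (fderiv ℝ ψ (x, t) (-σ, 1)) = 0 := by
  have hkc : Continuous fun p => fderiv ℝ ψ p (-σ, 1) :=
    (hψ.continuous_fderiv (by simp)).clm_apply continuous_const
  have hks : HasCompactSupport fun p => fderiv ℝ ψ p (-σ, 1) := hψs.fderiv_apply ℝ (-σ, 1)
  have e := fun t => integral_wave_eq hσ h (fun p => fderiv ℝ ψ p (-σ, 1)) t
  simp only [e]
  rw [integral_integral_swap (f := fun t y => h y * fderiv ℝ ψ (σ * (y - t), t) (-σ, 1))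
    (integrable_wave_prod hσ hh hkc hks).swap]
  refine integral_eq_zero_of_ae (ae_of_all _ fun y => ?_)
  simp only [Pi.zero_apply]
  rw [integral_const_mul]
  -- On a characteristic, with `y` fixed, the transport derivative of `ψ` is a total derivative in
  -- `t`, so its integral vanishes by compact support.
  have hd : ∀ t, HasDerivAt (fun t => ψ (σ * (y - t), t)) (fderiv ℝ ψ (σ * (y - t), t) (-σ, 1)) t := by
    intro t
    have h1 : HasDerivAt (fun t => (σ * (y - t), t)) (-σ, (1 : ℝ)) t := by
      have h2 : HasDerivAt (fun t => σ * (y - t)) (-σ) t := by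
        simpa using ((hasDerivAt_id t).const_sub y).const_mul σ
      exact h2.prodMk (hasDerivAt_id t)
    exact ((hψ.differentiable (by simp)) _).hasFDerivAt.comp_hasDerivAt t h1
  obtain ⟨R, hR, hz⟩ := exists_abs_le_of_hasCompactSupport hψs
  obtain ⟨R', hR', hz'⟩ := exists_abs_le_of_hasCompactSupport hks
  have c1 : HasCompactSupport fun t => ψ (σ * (y - t), t) :=
    HasCompactSupport.intro (isCompact_Icc (a := -R) (b := R)) fun t ht => by
      by_contra hne
      exact ht (abs_le.1 (hz _ t hne).2)
  have c2 : HasCompactSupport fun t => fderiv ℝ ψ (σ * (y - t), t) (-σ, 1) :=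
    HasCompactSupport.intro (isCompact_Icc (a := -R') (b := R')) fun t ht => by
      by_contra hne
      exact ht (abs_le.1 (hz' _ t hne).2)
  have hψc : Continuous ψ := hψ.continuous
  rw [integral_eq_zero_of_hasDerivAt_of_integrable hd
    (Continuous.integrable_of_hasCompactSupport
      (hkc.comp (g := fun p => fderiv ℝ ψ p (-σ, 1)) (f := fun t : ℝ => (σ * (y - t), t))
        (by fun_prop)) c2)
    (Continuous.integrable_of_hasCompactSupport (by fun_prop) c1), mul_zero]

/-- Integration by parts in space for a travelling wave. -/
theorem integral_wave_mul_deriv (hσ : σ = 1 ∨ σ = -1) {h H : ℝ → ℝ}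
    (hh : ∀ a b, IntervalIntegrable h volume a b) (hH : ∀ y, H y = H 0 + ∫ z in (0 : ℝ)..y, h z)
    {q q' : ℝ → ℝ} (hq : ∀ x, HasDerivAt q (q' x) x) (hq' : Continuous q')
    (hqs : HasCompactSupport q) (t : ℝ) :
    ∫ x, H (t + σ * x) * q' x = -(σ * ∫ x, h (t + σ * x) * q x) := by
  obtain ⟨R, hR⟩ := hqs.isCompact.isBounded.subset_closedBall (0 : ℝ)
  set S := max R 1 + 1 with hS
  have hS0 : 0 < S := by positivity
  have hRS : R < S := (le_max_left R 1).trans_lt (lt_add_one _)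
  have hts : tsupport q ⊆ Set.Ioo (-S) S := by
    refine hR.trans ?_
    rw [Real.closedBall_eq_Icc]
    exact Set.Icc_subset_Ioo (by linarith) (by linarith)
  have hz : ∀ x, x ∉ Set.Ioo (-S) S → q x = 0 := fun x hx => by
    by_contra hne
    exact hx (hts (subset_tsupport _ hne))
  have hq'e : q' = deriv q := funext fun x => (hq x).deriv.symm
  have hts' : Function.support q' ⊆ Set.Ioc (-S) S := by
    rw [hq'e]
    exact support_deriv_subset.trans (hts.trans Set.Ioo_subset_Ioc_self)
  have hts0 : Function.support q ⊆ Set.Ioc (-S) S :=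
    (subset_tsupport _).trans (hts.trans Set.Ioo_subset_Ioc_self)
  have hw := intervalIntegrable_wave hσ hh
  have hbp := integral_primitive_mul_deriv (a := -S) (b := S) (c := 0)
    (f := fun x => σ * h (t + σ * x)) (F := fun x => H (t + σ * x))
    (by rw [Set.uIcc_of_le (by linarith)]; exact ⟨by linarith, hS0.le⟩)
    ((hw t (-S) S).const_mul σ) (H t) (fun x _ => by
      have hs := intervalIntegral.smul_integral_comp_add_mul (a := 0) (b := x) h σ t
      rw [smul_eq_mul, mul_zero, add_zero] at hs
      rw [intervalIntegral.integral_const_mul, hs, hH (t + σ * x), hH t, add_assoc,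
        intervalIntegral.integral_add_adjacent_intervals (hh _ _) (hh _ _)]) hq hq'
  rw [hz S (by simp), hz (-S) (by simp), mul_zero, mul_zero, sub_zero, zero_sub] at hbp
  rw [intervalIntegral.integral_eq_integral_of_support_subset,
    intervalIntegral.integral_eq_integral_of_support_subset] at hbp
  · rw [hbp, ← integral_const_mul]
    simp only [mul_assoc]
  · exact (Function.support_mul_subset_right _ _).trans hts0
  · exact (Function.support_mul_subset_right _ _).trans hts'

end TravellingWave

/-! ### Continuity in time of travelling waves. -/

/-- Continuity of translations in `L²(ℝ)`. -/
theorem tendsto_eLpNorm_translate {f : ℝ → ℝ} (hf : MemLp f 2 volume) :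
    Tendsto (fun s : ℝ => eLpNorm (fun y => f (y + s) - f y) 2 volume) (𝓝 0) (𝓝 0) := by
  have : Fact ((2 : ENNReal) ≠ ⊤) := ⟨by simp⟩
  have hc : Continuous fun s : ℝ => (DomAddAct.mk s +ᵥ hf.toLp f : Lp ℝ 2 volume) :=
    (DomAddAct.continuous_mk).vadd continuous_const
  have h0 := hc.tendsto 0
  have hz : (DomAddAct.mk (0 : ℝ) +ᵥ hf.toLp f : Lp ℝ 2 volume) = hf.toLp f := by
    rw [DomAddAct.mk_zero, zero_vadd]
  rw [hz] at h0
  have hm : ∀ s : ℝ, MemLp (fun y => f (y + s)) 2 volume := fun s =>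
    hf.comp_measurePreserving (measurePreserving_add_right volume s)
  have h1 : Tendsto (fun s : ℝ => (hm s).toLp _) (𝓝 0) (𝓝 (hf.toLp f)) := by
    refine h0.congr fun s => ?_
    rw [DomAddAct.mk_vadd_toLp]
    congr 1
    funext y
    rw [vadd_eq_add, add_comm]
  exact (Lp.tendsto_Lp_iff_tendsto_eLpNorm'' _ hm _ hf).1 h1

theorem tendsto_l2Norm_translate {f : ℝ → ℝ} (hf : ∀ a b, MemL2 a b f) {c : ℝ} (hc : c ≠ 0)
    (a b s₀ : ℝ) :
    Tendsto (fun s => l2Norm a b (fun x => f (c * x + s) - f (c * x + s₀))) (𝓝 s₀) (𝓝 0) := by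
  -- `R` bounds every `|c x + s|` with `x ∈ (a,b)` and `|s - s₀| < 1`, so `f` can be truncated to a
  -- globally square integrable `F`; the factor `K` is the Jacobian of `x ↦ c x + s₀` in the `L²`
  -- norm.
  set R : ℝ := |c| * (|a| + |b|) + |s₀| + 1 with hR
  set F : ℝ → ℝ := (Set.Ioo (-R) R).indicator f with hF
  have hFm : MemLp F 2 volume := (memLp_indicator_iff_restrict measurableSet_Ioo).2 (hf _ _)
  set K : ENNReal := (ENNReal.ofReal |c⁻¹|) ^ (1 / (2 : ENNReal)).toReal with hK
  have hKtop : K ≠ ⊤ := ENNReal.rpow_ne_top_of_nonneg ENNReal.toReal_nonneg ENNReal.ofReal_ne_top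
  have hlim : Tendsto (fun s => K * eLpNorm (fun y => F (y + (s - s₀)) - F y) 2 volume)
      (𝓝 s₀) (𝓝 0) := by
    have hs : Tendsto (fun s : ℝ => s - s₀) (𝓝 s₀) (𝓝 0) := by
      have : Continuous fun s : ℝ => s - s₀ := by fun_prop
      simpa using this.tendsto s₀
    have := ENNReal.Tendsto.const_mul (a := K) ((tendsto_eLpNorm_translate hFm).comp hs)
      (Or.inr hKtop)
    simpa using this
  refine tendsto_of_tendsto_of_tendsto_of_le_of_le' tendsto_const_nhds hlim
    (Eventually.of_forall fun _ => zero_le) ?_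
  filter_upwards [Metric.ball_mem_nhds s₀ one_pos] with s hs
  rw [Metric.mem_ball, Real.dist_eq] at hs
  have hmem : ∀ x ∈ Set.Ioo a b, ∀ r, |r - s₀| < 1 → F (c * x + r) = f (c * x + r) := by
    intro x hx r hr
    refine Set.indicator_of_mem ?_ _
    have hx1 : |x| ≤ |a| + |b| := by
      rw [abs_le]
      constructor
      · linarith [neg_abs_le a, abs_nonneg b, hx.1]
      · linarith [le_abs_self b, abs_nonneg a, hx.2]
    have h1 : |c * x| ≤ |c| * (|a| + |b|) := by
      rw [abs_mul]
      exact mul_le_mul_of_nonneg_left hx1 (abs_nonneg c)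
    have h2 : |r| < |s₀| + 1 := by
      have := abs_sub_abs_le_abs_sub r s₀
      linarith
    have h3 : |c * x + r| < R := (abs_add_le _ _).trans_lt (by linarith)
    exact abs_lt.1 h3
  have e1 : l2Norm a b (fun x => f (c * x + s) - f (c * x + s₀)) =
      eLpNorm (fun x => F (c * x + s) - F (c * x + s₀)) 2 (volume.restrict (Set.Ioo a b)) := by
    refine eLpNorm_congr_ae ?_
    filter_upwards [ae_restrict_mem measurableSet_Ioo] with x hx
    rw [hmem x hx s hs, hmem x hx s₀ (by simp)]
  rw [e1]
  refine (eLpNorm_mono_measure _ Measure.restrict_le_self).trans ?_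
  set G : ℝ → ℝ := fun y => F (y + (s - s₀)) - F y with hG
  have hGm : AEStronglyMeasurable G volume :=
    ((hFm.comp_measurePreserving (measurePreserving_add_right volume (s - s₀))).sub hFm).1
  have hmap := map_restrict_affine hc s₀ Set.univ
  simp only [Set.preimage_univ, Measure.restrict_univ] at hmap
  have e2 : (fun x => F (c * x + s) - F (c * x + s₀)) = G ∘ (fun x => c * x + s₀) := by
    funext x
    simp only [hG, Function.comp_apply]
    congr 2
    ring
  have hGm' : AEStronglyMeasurable G (Measure.map (fun x => c * x + s₀) volume) := by
    rw [hmap]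
    exact hGm.smul_measure _
  rw [e2, ← eLpNorm_map_measure hGm' (by fun_prop), hmap,
    eLpNorm_smul_measure_of_ne_top (by simp), smul_eq_mul]

/-- In the moving frame the argument is `cη + (cv+d)t`, so the passage of time is a mere translation
of the profile. -/
theorem contL2_comp_affine {f : ℝ → ℝ} (hf : ∀ a b, MemL2 a b f) {c : ℝ} (hc : c ≠ 0)
    (d v L T : ℝ) : ContL2 v L T (fun x t => f (c * x + d * t)) := by
  refine ⟨fun t _ => MemL2.comp_affine hc (d * t) hf _ _, fun s _ => ?_⟩
  have h := tendsto_l2Norm_translate hf hc 0 L ((c * v + d) * s)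
  have hs : Tendsto (fun t : ℝ => (c * v + d) * t) (𝓝[Set.Icc 0 T] s) (𝓝 ((c * v + d) * s)) :=
    (Continuous.tendsto (by fun_prop) s).mono_left nhdsWithin_le_nhds
  refine (h.comp hs).congr fun t => ?_
  simp only [Function.comp_apply]
  congr 1
  funext x
  congr 2 <;> ring

theorem ContL2.add_mul {v L T : ℝ} {f g : ℝ → ℝ → ℝ} (hf : ContL2 v L T f) (hg : ContL2 v L T g)
    (c : ℝ) : ContL2 v L T (fun x t => f x t + c * g x t) := by
  refine ⟨fun t ht => MemLp.add (hf.1 t ht) ((hg.1 t ht).const_mul c), fun s hs => ?_⟩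
  have hlim : Tendsto (fun t => l2Norm 0 L (fun η => f (η + v * t) t - f (η + v * s) s) +
      ‖c‖ₑ * l2Norm 0 L (fun η => g (η + v * t) t - g (η + v * s) s)) (𝓝[Set.Icc 0 T] s) (𝓝 0) := by
    have h2 := ENNReal.Tendsto.const_mul (a := ‖c‖ₑ) (hg.2 s hs) (Or.inr enorm_ne_top)
    simpa using (hf.2 s hs).add h2
  refine tendsto_of_tendsto_of_tendsto_of_le_of_le' tendsto_const_nhds hlim
    (Eventually.of_forall fun _ => zero_le) ?_
  filter_upwards [self_mem_nhdsWithin] with t ht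
  have m1 : MemL2 0 L (fun η => f (η + v * t) t - f (η + v * s) s) :=
    MemLp.sub (hf.memL2 ht) (hf.memL2 hs)
  have m2 : MemL2 0 L (fun η => g (η + v * t) t - g (η + v * s) s) :=
    MemLp.sub (hg.memL2 ht) (hg.memL2 hs)
  have e : (fun η => f (η + v * t) t + c * g (η + v * t) t -
      (f (η + v * s) s + c * g (η + v * s) s)) =
      (fun η => f (η + v * t) t - f (η + v * s) s) +
        c • fun η => g (η + v * t) t - g (η + v * s) s := by
    funext η
    simp only [Pi.add_apply, Pi.smul_apply, smul_eq_mul]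
    ring
  rw [e]
  refine (eLpNorm_add_le m1.1 (m2.1.const_smul c) one_le_two).trans ?_
  rw [eLpNorm_const_smul]
  exact le_rfl

/-! ### Superpositions of travelling waves as weak solutions. -/

theorem IsTestFun.fderiv_apply_eq_zero {U : Set (ℝ × ℝ)} {ψ : ℝ × ℝ → ℝ} (h : IsTestFun U ψ)
    {p : ℝ × ℝ} (hp : p ∉ U) (w : ℝ × ℝ) : fderiv ℝ ψ p w = 0 := by
  have : p ∉ tsupport (fderiv ℝ ψ) := fun hc => hp (h.2.2 (tsupport_fderiv_subset ℝ hc))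
  rw [image_eq_zero_of_notMem_tsupport this, zero_apply]

theorem IsTestFun.hasDerivAt_fst {U : Set (ℝ × ℝ)} {ψ : ℝ × ℝ → ℝ} (h : IsTestFun U ψ) (x t : ℝ) :
    HasDerivAt (fun y => ψ (y, t)) (fderiv ℝ ψ (x, t) (1, 0)) x :=
  ((h.1.differentiable (by simp)) (x, t)).hasFDerivAt.comp_hasDerivAt x
    ((hasDerivAt_id x).prodMk (hasDerivAt_const x t))

theorem IsTestFun.hasDerivAt_snd {U : Set (ℝ × ℝ)} {ψ : ℝ × ℝ → ℝ} (h : IsTestFun U ψ) (x t : ℝ) :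
    HasDerivAt (fun s => ψ (x, s)) (fderiv ℝ ψ (x, t) (0, 1)) t :=
  ((h.1.differentiable (by simp)) (x, t)).hasFDerivAt.comp_hasDerivAt t
    ((hasDerivAt_const t x).prodMk (hasDerivAt_id t))

theorem integralQ_eq_integral {v L T : ℝ} {G : ℝ → ℝ → ℝ}
    (hG : ∀ x t, (x, t) ∉ domainQ v L T → G x t = 0) : integralQ v L T G = ∫ t, ∫ x, G x t := by
  have h1 : ∀ t, ∫ x in (v * t)..(L + v * t), G x t = ∫ x, G x t := by
    intro t
    refine intervalIntegral.integral_eq_integral_of_support_subset fun x hx => ?_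
    by_contra hn
    exact hx (hG x t fun hQ => hn ⟨hQ.2.2.1, hQ.2.2.2.le⟩)
  rw [integralQ]
  simp only [h1]
  refine intervalIntegral.integral_eq_integral_of_support_subset fun t ht => ?_
  by_contra hn
  refine ht (integral_eq_zero_of_ae (ae_of_all _ fun x => hG x t fun hQ => hn ⟨hQ.1, hQ.2.1.le⟩))

section Waves

variable {v L T : ℝ} {h₁ h₂ : ℝ → ℝ}

/-- Iterated integrals of a superposition of two travelling waves against test functions. -/
theorem integralQ_waves
    (hh₁ : ∀ a b, IntervalIntegrable h₁ volume a b) (hh₂ : ∀ a b, IntervalIntegrable h₂ volume a b)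
    {k₁ k₂ : ℝ × ℝ → ℝ} (hk₁ : Continuous k₁) (hk₂ : Continuous k₂) (hs₁ : HasCompactSupport k₁)
    (hs₂ : HasCompactSupport k₂) (hz₁ : ∀ p, p ∉ domainQ v L T → k₁ p = 0)
    (hz₂ : ∀ p, p ∉ domainQ v L T → k₂ p = 0) :
    integralQ v L T (fun x t => h₁ (t + 1 * x) * k₁ (x, t) + h₂ (t + -1 * x) * k₂ (x, t)) =
      (∫ t, ∫ x, h₁ (t + 1 * x) * k₁ (x, t)) + ∫ t, ∫ x, h₂ (t + -1 * x) * k₂ (x, t) := by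
  rw [integralQ_eq_integral (fun x t hp => by rw [hz₁ _ hp, hz₂ _ hp]; ring),
    ← integral_add (integrable_integral_wave (Or.inl rfl) hh₁ hk₁ hs₁)
      (integrable_integral_wave (Or.inr rfl) hh₂ hk₂ hs₂)]
  refine integral_congr_ae (ae_of_all _ fun t => ?_)
  exact integral_add (integrable_wave_mul (Or.inl rfl) hh₁ hk₁ hs₁ t)
    (integrable_wave_mul (Or.inr rfl) hh₂ hk₂ hs₂ t)

/-- The transport identity exchanges `∂_t ψ` for `σ ∂_x ψ`; integration by parts in `x` gives a
second factor `σ`, and `σ² = 1`. -/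
theorem integral_wave_weak_deriv {σ : ℝ} (hσ : σ = 1 ∨ σ = -1) {h H : ℝ → ℝ}
    (hh : ∀ a b, IntervalIntegrable h volume a b) (hH : ∀ y, H y = H 0 + ∫ z in (0 : ℝ)..y, h z)
    {ψ : ℝ × ℝ → ℝ} {U : Set (ℝ × ℝ)} (hψ : IsTestFun U ψ) :
    ∫ t, ∫ x, H (t + σ * x) * fderiv ℝ ψ (x, t) (0, 1) =
      -∫ t, ∫ x, h (t + σ * x) * ψ (x, t) := by
  have hHi : ∀ a b, IntervalIntegrable H volume a b := by
    have hc : Continuous H := by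
      rw [funext hH]
      exact continuous_const.add (intervalIntegral.continuous_primitive hh 0)
    exact fun a b => hc.intervalIntegrable a b
  have hkc : ∀ w, Continuous fun p => fderiv ℝ ψ p w := fun w =>
    (hψ.1.continuous_fderiv (by simp)).clm_apply continuous_const
  have hks : ∀ w, HasCompactSupport fun p => fderiv ℝ ψ p w := fun w => hψ.2.1.fderiv_apply ℝ w
  have h0 := integral_wave_transport hσ hHi hψ.1 hψ.2.1
  have hsplit : ∀ t x : ℝ, H (t + σ * x) * fderiv ℝ ψ (x, t) (-σ, 1) =
      H (t + σ * x) * fderiv ℝ ψ (x, t) (0, 1) - σ * (H (t + σ * x) * fderiv ℝ ψ (x, t) (1, 0)) := by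
    intro t x
    have : ((-σ, 1) : ℝ × ℝ) = (0, 1) - σ • (1, 0) := by ext <;> simp
    rw [this, map_sub, map_smul, smul_eq_mul]
    ring
  have i1 := integrable_integral_wave hσ hHi (hkc (0, 1)) (hks (0, 1))
  have i2 := integrable_integral_wave hσ hHi (hkc (1, 0)) (hks (1, 0))
  have e : ∀ t, ∫ x, H (t + σ * x) * fderiv ℝ ψ (x, t) (-σ, 1) =
      (∫ x, H (t + σ * x) * fderiv ℝ ψ (x, t) (0, 1)) -
        σ * ∫ x, H (t + σ * x) * fderiv ℝ ψ (x, t) (1, 0) := by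
    intro t
    rw [← integral_const_mul, ← integral_sub
      (integrable_wave_mul hσ hHi (hkc (0, 1)) (hks (0, 1)) t)
      ((integrable_wave_mul hσ hHi (hkc (1, 0)) (hks (1, 0)) t).const_mul σ)]
    exact integral_congr_ae (ae_of_all _ fun x => hsplit t x)
  have hbp : ∀ t, ∫ x, H (t + σ * x) * fderiv ℝ ψ (x, t) (1, 0) =
      -(σ * ∫ x, h (t + σ * x) * ψ (x, t)) := by
    intro t
    refine integral_wave_mul_deriv hσ hh hH (fun x => hψ.hasDerivAt_fst x t)
      ((hkc (1, 0)).comp (by fun_prop)) ?_ t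
    obtain ⟨R, hR, hz⟩ := exists_abs_le_of_hasCompactSupport hψ.2.1
    refine HasCompactSupport.intro (isCompact_Icc (a := -R) (b := R)) fun x hx => ?_
    by_contra hne
    exact hx (abs_le.1 (hz x t hne).1)
  simp only [e] at h0
  rw [integral_sub i1 (i2.const_mul σ), integral_const_mul] at h0
  simp only [hbp] at h0
  rw [integral_neg, integral_const_mul] at h0
  have hσ2 := sq_eq_one_of_sign hσ
  linear_combination h0 - (∫ t, ∫ x, h (t + σ * x) * ψ (x, t)) * hσ2

/-- A superposition of travelling waves has the expected weak time derivative. -/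
theorem waves_weak_deriv {H₁ H₂ : ℝ → ℝ}
    (hh₁ : ∀ a b, IntervalIntegrable h₁ volume a b) (hh₂ : ∀ a b, IntervalIntegrable h₂ volume a b)
    (hH₁ : ∀ y, H₁ y = H₁ 0 + ∫ z in (0 : ℝ)..y, h₁ z)
    (hH₂ : ∀ y, H₂ y = H₂ 0 + ∫ z in (0 : ℝ)..y, h₂ z) {ψ : ℝ × ℝ → ℝ}
    (hψ : IsTestFun (domainQ v L T) ψ) :
    integralQ v L T (fun x t => (H₁ (t + 1 * x) + H₂ (t + -1 * x)) * dT ψ x t) =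
      -integralQ v L T (fun x t => (h₁ (t + 1 * x) + h₂ (t + -1 * x)) * ψ (x, t)) := by
  have hHi : ∀ {h H : ℝ → ℝ}, (∀ a b, IntervalIntegrable h volume a b) →
      (∀ y, H y = H 0 + ∫ z in (0 : ℝ)..y, h z) → ∀ a b, IntervalIntegrable H volume a b := by
    intro h H hh hH a b
    have hc : Continuous H := by
      rw [funext hH]
      exact continuous_const.add (intervalIntegral.continuous_primitive hh 0)
    exact hc.intervalIntegrable a b
  have hkc : Continuous fun p => fderiv ℝ ψ p (0, 1) :=
    (hψ.1.continuous_fderiv (by simp)).clm_apply continuous_const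
  have hks : HasCompactSupport fun p => fderiv ℝ ψ p (0, 1) := hψ.2.1.fderiv_apply ℝ (0, 1)
  have hkz : ∀ p, p ∉ domainQ v L T → fderiv ℝ ψ p (0, 1) = 0 :=
    fun p hp => hψ.fderiv_apply_eq_zero hp _
  have e1 := integralQ_waves (hHi hh₁ hH₁) (hHi hh₂ hH₂) hkc hkc hks hks hkz hkz
  have e2 := integralQ_waves hh₁ hh₂ hψ.1.continuous hψ.1.continuous hψ.2.1 hψ.2.1
    (fun p => hψ.eq_zero) (fun p => hψ.eq_zero)
  rw [integral_wave_weak_deriv (Or.inl rfl) hh₁ hH₁ hψ,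
    integral_wave_weak_deriv (Or.inr rfl) hh₂ hH₂ hψ, ← neg_add, ← e2] at e1
  simp only [add_mul, dT, (hψ.hasDerivAt_snd _ _).deriv]
  exact e1

/-- A superposition of travelling waves solves the wave equation weakly. -/
theorem waves_weak_wave_equation
    (hh₁ : ∀ a b, IntervalIntegrable h₁ volume a b) (hh₂ : ∀ a b, IntervalIntegrable h₂ volume a b)
    {ψ : ℝ × ℝ → ℝ} (hψ : IsTestFun (domainQ v L T) ψ) :
    integralQ v L T (fun x t => (h₁ (t + 1 * x) + h₂ (t + -1 * x)) * dT ψ x t -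
      (h₁ (t + 1 * x) - h₂ (t + -1 * x)) * dX ψ x t) = 0 := by
  have hkc : ∀ w, Continuous fun p => fderiv ℝ ψ p w := fun w =>
    (hψ.1.continuous_fderiv (by simp)).clm_apply continuous_const
  have hks : ∀ w, HasCompactSupport fun p => fderiv ℝ ψ p w := fun w => hψ.2.1.fderiv_apply ℝ w
  have hkz : ∀ w, ∀ p, p ∉ domainQ v L T → fderiv ℝ ψ p w = 0 :=
    fun w p hp => hψ.fderiv_apply_eq_zero hp _
  -- The integrand regroups as `h₁(ψ_t - ψ_x) + h₂(ψ_t + ψ_x)`: each wave meets only the transport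
  -- operator that annihilates it.
  have e1 := integralQ_waves hh₁ hh₂ (hkc (-1, 1)) (hkc (- -1, 1)) (hks _) (hks _) (hkz _)
    (hkz _)
  rw [integral_wave_transport (Or.inl rfl) hh₁ hψ.1 hψ.2.1,
    integral_wave_transport (Or.inr rfl) hh₂ hψ.1 hψ.2.1, add_zero] at e1
  rw [← e1]
  congr 1
  funext x t
  have s1 : ((-1, 1) : ℝ × ℝ) = (0, 1) - (1, 0) := by ext <;> simp
  have s2 : ((- -1, 1) : ℝ × ℝ) = (0, 1) + (1, 0) := by ext <;> simp
  rw [s1, s2, map_sub, map_add, dT, dX, (hψ.hasDerivAt_snd _ _).deriv,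
    (hψ.hasDerivAt_fst _ _).deriv]
  ring

end Waves

theorem sub_eq_mul_integral_wave {h H : ℝ → ℝ} (hh : ∀ a b, IntervalIntegrable h volume a b)
    (hH : ∀ y, H y = H 0 + ∫ z in (0 : ℝ)..y, h z) (σ t a x : ℝ) :
    H (t + σ * x) - H (t + σ * a) = σ * ∫ y in a..x, h (t + σ * y) := by
  rw [intervalIntegral.mul_integral_comp_add_mul, hH (t + σ * x), hH (t + σ * a),
    ← intervalIntegral.integral_interval_sub_left (hh 0 (t + σ * x)) (hh 0 (t + σ * a))]
  ring

/-- The problem has a solution, given by two travelling waves with the periodic profile of the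
data. -/
theorem IsProfile.isSolution {v L T : ℝ} (hv0 : 0 < v) (hv1 : v < 1) (hL : 0 < L)
    {φ0 φ0x φ1 f : ℝ → ℝ} (h0 : HasH10Deriv 0 L φ0 φ0x) (h1 : MemL2 0 L φ1)
    (hf : IsProfile v L φ0x φ1 f) :
    IsSolution v L T φ0 φ1 (fun x t => (∫ y in (0 : ℝ)..(t + 1 * x), f y) +
      -∫ y in (0 : ℝ)..(gam v * (t + -1 * x)), f y) := by
  have hγ := gam_pos hv0 hv1
  set γ := gam v with hγd
  have hγv : γ * (1 - v) = 1 + v := by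
    rw [hγd, gam]
    exact div_mul_cancel₀ _ (by linarith)
  have hP : 0 < L₂ v L := by rw [L₂_eq hv1]; positivity
  have hfi := intervalIntegrable_of_memL2 hf.memL2
  set F : ℝ → ℝ := fun y => ∫ z in (0 : ℝ)..y, f z with hF
  set G : ℝ → ℝ := fun z => -F (γ * z) with hG
  set g : ℝ → ℝ := fun z => -γ * f (γ * z) with hg
  have hFc : Continuous F := intervalIntegral.continuous_primitive hfi 0
  have hGc : Continuous G := (hFc.comp (continuous_const.mul continuous_id)).neg
  have hgm : ∀ a b, MemL2 a b g := fun a b => by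
    have h := (MemL2.comp_affine hγ.ne' 0 hf.memL2 a b).const_mul (-γ)
    simp only [add_zero] at h
    exact h
  have hgi := intervalIntegrable_of_memL2 hgm
  have hFd : ∀ y, F y = F 0 + ∫ z in (0 : ℝ)..y, f z := fun y => by
    simp only [hF, intervalIntegral.integral_same, zero_add]
  have hGd : ∀ y, G y = G 0 + ∫ z in (0 : ℝ)..y, g z := fun y => by
    have h := intervalIntegral.mul_integral_comp_mul_left (a := 0) (b := y) (f := f) γ
    rw [mul_zero] at h
    simp only [hG, hF, hg, mul_zero, intervalIntegral.integral_same, neg_zero, zero_add]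
    rw [intervalIntegral.integral_const_mul, neg_mul, h]
  have hFm : ∀ a b, MemL2 a b F := fun a b => memL2_of_continuousOn hFc.continuousOn
  have hGm : ∀ a b, MemL2 a b G := fun a b => memL2_of_continuousOn hGc.continuousOn
  have hper : Function.Periodic F (L₂ v L) :=
    periodic_primitive hf.periodic hfi
      (hf.integral_eq_zero hv0 hv1 hL h0.2.1 h1 (h0.integral_eq_zero hL.le))
  have hwave : ∀ {k l : ℝ → ℝ}, (∀ a b, MemL2 a b k) → (∀ a b, MemL2 a b l) → ∀ c,
      ContL2 v L T (fun x t => k (t + 1 * x) + c * l (t + -1 * x)) := by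
    intro k l hk hl c
    have h := (contL2_comp_affine hk one_ne_zero 1 v L T).add_mul
      (contL2_comp_affine hl (neg_ne_zero.2 one_ne_zero) 1 v L T) c
    refine cast (congrArg _ ?_) h
    funext x t
    rw [one_mul t, add_comm t, add_comm t]
  -- Exhibits the solution as a spatial primitive; vanishing at both moving endpoints then gives the
  -- mean-zero condition needed for `H¹₀`.
  have hprim : ∀ t a x, F (t + 1 * x) + G (t + -1 * x) - (F (t + 1 * a) + G (t + -1 * a)) =
      ∫ y in a..x, (f (t + 1 * y) + -1 * g (t + -1 * y)) := by
    intro t a x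
    have i1 : ∀ a b, IntervalIntegrable (fun y => f (t + 1 * y)) volume a b :=
      intervalIntegrable_of_memL2 fun a b => by
        simpa only [add_comm] using MemL2.comp_affine one_ne_zero t hf.memL2 a b
    have i2 : ∀ a b, IntervalIntegrable (fun y => g (t + -1 * y)) volume a b :=
      intervalIntegrable_of_memL2 fun a b => by
        simpa only [add_comm] using MemL2.comp_affine (neg_ne_zero.2 one_ne_zero) t hgm a b
    rw [intervalIntegral.integral_add (i1 _ _) ((i2 _ _).const_mul _),
      intervalIntegral.integral_const_mul]
    linear_combination sub_eq_mul_integral_wave hfi hFd 1 t a x +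
      sub_eq_mul_integral_wave hgi hGd (-1) t a x
  have hleft : ∀ t, F (t + 1 * (v * t)) + G (t + -1 * (v * t)) = 0 := by
    intro t
    have e : γ * (t + -1 * (v * t)) = t + 1 * (v * t) := by linear_combination t * hγv
    simp only [hG, e, add_neg_cancel]
  -- At the right endpoint the two arguments differ by exactly one period of `F`.
  have hright : ∀ t, F (t + 1 * (L + v * t)) + G (t + -1 * (L + v * t)) = 0 := by
    intro t
    have e : t + 1 * (L + v * t) = γ * (t + -1 * (L + v * t)) + L₂ v L := by
      rw [L₂_eq hv1]
      linear_combination -t * hγv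
    simp only [hG, e, hper (γ * (t + -1 * (L + v * t))), add_neg_cancel]
  refine ⟨fun x t => f (t + 1 * x) + -1 * g (t + -1 * x), fun x t => f (t + 1 * x) + 1 * g (t + -1 * x),
    fun t ht => ?_, ?_, hwave hf.memL2 hgm _, hwave hf.memL2 hgm _, fun ψ hψ => ?_, fun ψ hψ => ?_,
    ?_, ?_⟩
  · refine hasH10Deriv_of_eq_integral (by linarith) ((hwave hf.memL2 hgm _).1 t ht) ?_
      fun x _ => ?_
    · rw [← hprim, hleft, hright, sub_zero]
    · rw [← hprim, hleft, sub_zero]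
  · simpa only [one_mul] using hwave hFm hGm 1
  · simp only [one_mul (g _)]
    exact waves_weak_deriv hfi hgi hFd hGd hψ
  · simp only [one_mul (g _), neg_one_mul (g _), ← sub_eq_add_neg]
    exact waves_weak_wave_equation hfi hgi hψ
  · filter_upwards [h0.ae_eq_integral, ae_restrict_mem measurableSet_Ioo] with x hx hm
    rw [hx, ← hf.integral_sub_integral_eq hv0 hv1 (Set.Ioo_subset_Icc_self hm), zero_add, zero_add,
      one_mul, neg_one_mul, sub_eq_add_neg]
  · filter_upwards [ae_restrict_mem measurableSet_Ioo] with x hx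
    have hl := hf.left x hx
    simp only [hg, zero_add, one_mul]
    rw [hf.right x hx, neg_one_mul, mul_neg, ← neg_mul]
    linear_combination -hl

end MovingString

theorem theorem2p1 (v L T : ℝ) (hv0 : 0 < v) (hv1 : v < 1) (hL : 0 < L) (hT : 0 < T)
    (φ0 φ0x φ1 : ℝ → ℝ)
    (h0 : MovingString.HasH10Deriv 0 L φ0 φ0x) (h1 : MovingString.MemL2 0 L φ1) :
    -- the two coefficient formulas agree
    (∀ n : ℤ, n ≠ 0 →
      MovingString.coeffPlus v L φ0x φ1 n = MovingString.coeffMinus v L φ0x φ1 n) ∧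
    -- the problem has a solution, which is the sum of the series at every point
    (∃ φ : ℝ → ℝ → ℝ, MovingString.IsSolution v L T φ0 φ1 φ ∧
      ∀ t ∈ Set.Icc 0 T, ∀ x ∈ Set.Icc (v * t) (L + v * t),
        HasSum (fun n : {n : ℤ // n ≠ 0} =>
          MovingString.coeffPlus v L φ0x φ1 n * MovingString.mode v L n x t) ((φ x t : ℝ) : ℂ)) ∧
    -- every solution is the sum of the series: almost everywhere in `I_t` for each `t`, and
    -- everywhere in `I_t` for the continuous representative
    (∀ φ : ℝ → ℝ → ℝ, MovingString.IsSolution v L T φ0 φ1 φ →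
      ∀ t ∈ Set.Icc 0 T,
        (∀ᵐ x ∂(MeasureTheory.volume.restrict (Set.Ioo (v * t) (L + v * t))),
          HasSum (fun n : {n : ℤ // n ≠ 0} =>
            MovingString.coeffPlus v L φ0x φ1 n * MovingString.mode v L n x t)
            ((φ x t : ℝ) : ℂ)) ∧
        (ContinuousOn (fun x => φ x t) (Set.Ioo (v * t) (L + v * t)) →
          ∀ x ∈ Set.Ioo (v * t) (L + v * t),
            HasSum (fun n : {n : ℤ // n ≠ 0} =>
              MovingString.coeffPlus v L φ0x φ1 n * MovingString.mode v L n x t)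
              ((φ x t : ℝ) : ℂ))) := by
  obtain ⟨f, hf⟩ := MovingString.exists_isProfile hv0 hv1 hL h0.2.1 h1
  refine ⟨fun n _ => ?_, ⟨_, hf.isSolution hv0 hv1 hL h0 h1, fun t _ x _ => ?_⟩,
    fun φ hφ t ht => ⟨hφ.ae_hasSum hv0 hv1 hL hT h0 h1 ht,
      hφ.hasSum_of_continuousOn hv0 hv1 hL hT h0 h1 ht⟩⟩
  · rw [hf.coeffPlus_eq_integral hv0 hv1 hL n, hf.coeffMinus_eq_integral hv0 hv1 hL n]
  · rw [one_mul, neg_one_mul, ← sub_eq_add_neg, ← sub_eq_add_neg]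
    exact hf.hasSum hv0 hv1 hL h0.2.1 h1 (h0.integral_eq_zero hL.le) x t
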